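/- Let $d\ge 1$, $0<\alpha<\min(2,d)$, and let $\Omega\subset\mathbb R^d$ be a bounded open set. Put $$\mathcal E(f,g)=\tfrac12\mathcal A(d,\alpha)\int_{\mathbb R^d}\int_{\mathbb R^d}\frac{(f(x)-f(y))(g(x)-g(y))}{|x-y|^{d+\alpha}}\,dx\,dy,\qquad \mathcal A(d,\alpha)=\frac{\alpha\,\Gamma(\frac{d+\alpha}2)}{2^{1-\alpha}\pi^{d/2}\Gamma(1-\frac\alpha2)},$$ $\mathcal E[f]=\mathcal E(f,f)$, $W^{\alpha/2,2}(\mathbb R^d)=\{f\in L^2(\mathbb R^d):\mathcal E[f]<\infty\}$, and let $\mathcal E_\Omega$ be the restriction of $\mathcal E$ to $$W_0^{\alpha/2,2}(\Omega)=\{f\in W^{\alpha/2,2}(\mathbb R^d): f=0 \text{ a.e. on } \mathbb R^d\setminus\Omega\}.$$ Let $V\ge 0$ be a Borel function in $L^1_{loc}(\Omega)$, let $k\in\mathbb N$, $V_k=\min(V,k)$, and let $L_k$ be the self-adjoint operator in $L^2(\Omega)$ associated with the closed quadratic form $f\mapsto\mathcal E_\Omega[f]-\int_\Omega V_kf^2\,dx$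 with domain $W_0^{\alpha/2,2}(\Omega)$. Let $u_0\in L^2(\Omega)$ with $u_0\ge 0$ a.e. and $u_0$ not a.e. zero, and let $u_k(t)=e^{-tL_k}u_0$, extended by $0$ outside $\Omega$; this is the nonnegative solution of the heat equation $-\partial_t u=(-\Delta)^{\alpha/2}|_\Omega u-V_ku$ on $(0,\infty)\times\Omega$ with $u=0$ on $\Omega^c$ and $u(0,\cdot)=u_0$. Let $\phi\in W_0^{\alpha/2,2}(\Omega)\cap L^\infty$ have (essential) support a compact subset of $\Omega$. Then for every $t>0$: $u_k(t)>0$ a.e. on $\Omega$ (so that $\phi^2/u_k(t)$, understood as $0$ outside $\Omega$, is defined a.e.), $u_k(t)\in W_0^{\alpha/2,2}(\Omega)$, $\phi^2/u_k(t)\in W_0^{\alpha/2,2}(\Omega)$, and $$\mathcal E_\Omega\Big(u_k(t),\frac{\phi^2}{u_k(t)}\Big)\le\mathcal E_\Omega[\phi].$$ -/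

import Mathlib

open MeasureTheory Filter Topology

noncomputable section

namespace FracHeat

/-- The ambient Euclidean space `ℝ^d`. -/
abbrev Rd (d : ℕ) : Type := EuclideanSpace ℝ (Fin d)

/-- The constant `A(d, α) = α Γ((d+α)/2) / (2^(1-α) π^(d/2) Γ(1-α/2))`. -/
def constA (d : ℕ) (α : ℝ) : ℝ :=
  α * Real.Gamma ((d + α) / 2) /
    ((2 : ℝ) ^ (1 - α) * Real.pi ^ ((d : ℝ) / 2) * Real.Gamma (1 - α / 2))

/-- The quadratic form of the fractional Laplacian,
`E(f, g) = (A(d, α) / 2) ∫∫ (f(x) - f(y)) (g(x) - g(y)) / |x - y|^(d+α) dx dy`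
(absolutely convergent as soon as `f` and `g` lie in `W^{α/2,2}(ℝ^d)`). -/
def energy {d : ℕ} (α : ℝ) (f g : Rd d → ℝ) : ℝ :=
  1 / 2 * constA d α *
    ∫ p : Rd d × Rd d,
      (f p.1 - f p.2) * (g p.1 - g p.2) / ‖p.1 - p.2‖ ^ ((d : ℝ) + α)
      ∂((volume : Measure (Rd d)).prod (volume : Measure (Rd d)))

/-- `f ∈ W^{α/2,2}(ℝ^d)`: `f` is square integrable and `E[f] < ∞`. -/
def MemW {d : ℕ} (α : ℝ) (f : Rd d → ℝ) : Prop :=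
  MemLp f 2 (volume : Measure (Rd d)) ∧
    Integrable (fun p : Rd d × Rd d => (f p.1 - f p.2) ^ 2 / ‖p.1 - p.2‖ ^ ((d : ℝ) + α))
      ((volume : Measure (Rd d)).prod (volume : Measure (Rd d)))

/-- `f ∈ W_0^{α/2,2}(Ω)`: `f ∈ W^{α/2,2}(ℝ^d)` and `f = 0` almost everywhere outside `Ω`. -/
def MemW0 {d : ℕ} (α : ℝ) (Ω : Set (Rd d)) (f : Rd d → ℝ) : Prop :=
  MemW α f ∧ ∀ᵐ x ∂(volume : Measure (Rd d)), x ∉ Ω → f x = 0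

/-- The real Hilbert space `L²(Ω)`. -/
abbrev L2 {d : ℕ} (Ω : Set (Rd d)) : Type :=
  Lp ℝ 2 ((volume : Measure (Rd d)).restrict Ω)

/-- The extension by zero of an element of `L²(Ω)` to a function on `ℝ^d`. -/
def ext0 {d : ℕ} {Ω : Set (Rd d)} (f : L2 Ω) : Rd d → ℝ :=
  Ω.indicator (f : Rd d → ℝ)

/-- The graph of the operator in `L²(Ω)` associated with the quadratic form `E_Ω - W`
with domain `W_0^{α/2,2}(Ω)`: `f` lies in the domain of the operator and is mapped to `g` iff
`f ∈ W_0^{α/2,2}(Ω)` and `E_Ω(f, v) - ∫_Ω W f v dx = ⟪g, v⟫` for all `v ∈ W_0^{α/2,2}(Ω)`. -/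
def formOperatorGraph {d : ℕ} (α : ℝ) (Ω : Set (Rd d)) (W : Rd d → ℝ) : Set (L2 Ω × L2 Ω) :=
  {p | MemW0 α Ω (ext0 p.1) ∧
    ∀ v : L2 Ω, MemW0 α Ω (ext0 v) →
      energy α (ext0 p.1) (ext0 v) - ∫ x in Ω, W x * p.1 x * v x = inner ℝ p.2 v}

/-- `S t = e^{-tL}` for `t ≥ 0`, where `L` is the operator with graph `G`: the family `(S t)_{t ≥ 0}`
is the strongly continuous semigroup of bounded operators whose infinitesimal generator is
exactly `-L` (in particular with the same domain). Only the values `S t` with `t ≥ 0` matter. -/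
structure IsSemigroupOf {H : Type*} [NormedAddCommGroup H] [NormedSpace ℝ H]
    (G : Set (H × H)) (S : ℝ → H →L[ℝ] H) : Prop where
  zero : S 0 = ContinuousLinearMap.id ℝ H
  add : ∀ s t : ℝ, 0 ≤ s → 0 ≤ t → S (s + t) = (S s).comp (S t)
  cont : ∀ f : H, ContinuousOn (fun t => S t f) (Set.Ici 0)
  generator : ∀ f g : H,
    (f, g) ∈ G ↔ Tendsto (fun t : ℝ => t⁻¹ • (S t f - f)) (𝓝[>] 0) (𝓝 (-g))

end FracHeat

end

/-!
The inequality itself is the discrete Picone inequality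
`(a - b) (p² / a - q² / b) ≤ (p - q)²`, integrated against the kernel (`picone`,
`energy_le_energy`). What has to be shown is that both arguments of the form belong to
`W_0^{α/2,2}(Ω)`, and for `φ² / u(t)` this needs `u(t) ≥ c > 0` on the support of `φ`.

*Regularity.* The operator `L_k` is symmetric and bounded below. For a strongly continuous semigroup
generated by such an operator, differentiation along orbits gives self-adjointness and, after
rescaling to a nonnegative operator, the smoothing estimate `t ‖L e^{-tL} f‖ ≤ ‖f‖`
(`IsSemigroupOf.mul_norm_apply_le`). As the generator is closed and densely defined, the semigroup
maps all of `L²(Ω)` into its domain for `t > 0` (`IsSemigroupOf.exists_mem`), in particular into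
`W_0^{α/2,2}(Ω)`.

*Comparison.* For `v ≥ 0` and `w(s) = s v - e^{-sL} f`, Gronwall's inequality for `‖w(s)₊‖²` yields
`s v ≤ e^{-sL} f` whenever `⟪v, w₊⟫ + s E(v, w₊) ≤ E(w, w₊)` (`smul_le_apply`); the bounded potential
only contributes to the Gronwall constant. With `v = 0` this is positivity (`apply_nonneg`).

*Lower bound.* Because the form is nonlocal and `Ω` is bounded, `E(w, w₊) ≥ c ∫ w₊ ∫ w₋`
(`exists_mul_integral_le_energy`), and the mass of `w₋` is at least the mass of the solution minus
that of `s v`. The mass of the solution is bounded below on compact time intervals, since a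
symmetric semigroup is injective (`IsSemigroupOf.apply_ne_zero`). On the other hand, the
semiconvexity of `(r² - |x - x₀|²)₊` gives `E(bump, g) ≤ C ∫ g` for `g ≥ 0`
(`exists_energy_bump_le`). Hence a small multiple of the bump is an admissible `v`, and `u(t)` is
bounded below near every point of `Ω` (`exists_le_apply_ball`). No heat kernel estimate and no
connectedness of `Ω` is needed.
-/

namespace FracHeat

/-! ### Strongly continuous semigroups generated by symmetric operators -/

namespace IsSemigroupOf

variable {H : Type*} [NormedAddCommGroup H] [InnerProductSpace ℝ H]
  {G : Set (H × H)} {S : ℝ → H →L[ℝ] H}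

lemma apply_add (hS : IsSemigroupOf G S) {s t : ℝ} (hs : 0 ≤ s) (ht : 0 ≤ t) (f : H) :
    S (s + t) f = S s (S t f) := by
  rw [hS.add s t hs ht]; rfl

lemma apply_zero (hS : IsSemigroupOf G S) (f : H) : S 0 f = f := by
  rw [hS.zero]; rfl

lemma apply_comm (hS : IsSemigroupOf G S) {s t : ℝ} (hs : 0 ≤ s) (ht : 0 ≤ t) (f : H) :
    S s (S t f) = S t (S s f) := by
  rw [← hS.apply_add hs ht, add_comm, hS.apply_add ht hs]

lemma map_mem (hS : IsSemigroupOf G S) {f g : H} (hfg : (f, g) ∈ G) {t : ℝ} (ht : 0 ≤ t) :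
    (S t f, S t g) ∈ G := by
  rw [hS.generator] at hfg ⊢
  have h := ((S t).continuous.tendsto (-g)).comp hfg
  rw [map_neg] at h
  refine h.congr' ?_
  filter_upwards [self_mem_nhdsWithin] with s hs
  simp only [Function.comp, map_smul, map_sub]
  rw [hS.apply_comm ht (le_of_lt hs)]

lemma sub_mem (hS : IsSemigroupOf G S) {f g f' g' : H} (h : (f, g) ∈ G) (h' : (f', g') ∈ G) :
    (f - f', g - g') ∈ G := by
  rw [hS.generator] at h h' ⊢
  have := h.sub h'
  rw [show -g - -g' = -(g - g') by abel] at this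
  refine this.congr fun s => ?_
  rw [map_sub, ← smul_sub]
  congr 1
  abel

lemma continuous_orbit (hS : IsSemigroupOf G S) (f : H) : Continuous fun t => S (max t 0) f :=
  (hS.cont f).comp_continuous (by fun_prop) fun t => le_max_right t 0

lemma hasDerivWithinAt (hS : IsSemigroupOf G S) {f g : H} (hfg : (f, g) ∈ G) {t : ℝ}
    (ht : 0 ≤ t) : HasDerivWithinAt (fun s => S s f) (-(S t g)) (Set.Ioi t) t := by
  rw [hasDerivWithinAt_iff_tendsto_slope' (by simp)]
  have h := (hS.generator _ _).1 (hS.map_mem hfg ht)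
  have hm : Tendsto (fun s => s - t) (𝓝[>] t) (𝓝[>] 0) := by
    refine tendsto_nhdsWithin_iff.2 ⟨?_, ?_⟩
    · have : Tendsto (fun s => s - t) (𝓝 t) (𝓝 (t - t)) := by
        apply Continuous.tendsto; fun_prop
      rw [sub_self] at this
      exact this.mono_left nhdsWithin_le_nhds
    · filter_upwards [self_mem_nhdsWithin] with s hs
      exact sub_pos.2 (Set.mem_Ioi.1 hs)
  refine (h.comp hm).congr' ?_
  filter_upwards [self_mem_nhdsWithin] with s hs
  simp only [Function.comp, slope, vsub_eq_sub]
  rw [← hS.apply_add (sub_nonneg.2 (le_of_lt hs)) ht, sub_add_cancel]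

/-- Adding the constant `c` to the operator with graph `G` multiplies the semigroup by `e^{-ct}`. -/
lemma rescale (hS : IsSemigroupOf G S) (c : ℝ) :
    IsSemigroupOf {p : H × H | (p.1, p.2 - c • p.1) ∈ G} (fun t => Real.exp (-(c * t)) • S t) where
  zero := by simp [hS.zero]
  add s t hs ht := by
    ext f
    simp only [_root_.smul_apply, ContinuousLinearMap.comp_apply, map_smul,
      hS.apply_add hs ht, smul_smul, ← Real.exp_add]
    congr 2
    ring
  cont f := by
    simp only [_root_.smul_apply]
    exact ContinuousOn.smul (by fun_prop) (hS.cont f)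
  generator f g := by
    have he : HasDerivAt (fun t : ℝ => Real.exp (-(c * t))) (-c) 0 := by
      have := (((hasDerivAt_id (0 : ℝ)).const_mul c).neg).exp
      simpa using this
    have he1 := he.tendsto_slope_zero_right
    simp only [zero_add, mul_zero, neg_zero, Real.exp_zero, smul_eq_mul] at he1
    have he0 : Tendsto (fun t : ℝ => Real.exp (-(c * t))) (𝓝[>] 0) (𝓝 1) := by
      have h := he.continuousAt.tendsto
      simp only [mul_zero, neg_zero, Real.exp_zero] at h
      exact h.mono_left nhdsWithin_le_nhds
    have he0' : Tendsto (fun t : ℝ => Real.exp (c * t)) (𝓝[>] 0) (𝓝 1) := by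
      have h := (he0.inv₀ one_ne_zero)
      simpa [← Real.exp_neg] using h
    simp only [Set.mem_ofPred_eq, hS.generator, _root_.smul_apply]
    constructor
    · intro h
      have := (he0.smul h).add (he1.smul_const f)
      rw [show (1 : ℝ) • -(g - c • f) + -c • f = -g by module] at this
      refine this.congr fun t => ?_
      module
    · intro h
      have := he0'.smul (h.sub (he1.smul_const f))
      rw [show (1 : ℝ) • (-g - -c • f) = -(g - c • f) by module] at this
      refine this.congr fun t => ?_
      have e : Real.exp (c * t) * Real.exp (-(c * t)) = 1 := by simp [← Real.exp_add]
      calc Real.exp (c * t) • (t⁻¹ • (Real.exp (-(c * t)) • (S t) f - f) -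
            (t⁻¹ * (Real.exp (-(c * t)) - 1)) • f)
          = (Real.exp (c * t) * Real.exp (-(c * t))) • t⁻¹ • (S t f - f) := by module
        _ = _ := by rw [e, one_smul]

variable [CompleteSpace H]

lemma apply_sub_eq_integral (hS : IsSemigroupOf G S) {f g : H} (hfg : (f, g) ∈ G) {t : ℝ}
    (ht : 0 ≤ t) : S t f - f = -∫ s in (0 : ℝ)..t, S (max s 0) g := by
  have h := intervalIntegral.integral_eq_sub_of_hasDeriv_right (a := 0) (b := t)
    (f := fun s => S s f) (f' := fun s => -S (max s 0) g)
    ((hS.cont f).mono (by rw [Set.uIcc_of_le ht]; exact Set.Icc_subset_Ici_self))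
    (fun x hx => by
      rw [min_eq_left ht] at hx
      simpa [max_eq_left hx.1.le] using hS.hasDerivWithinAt hfg hx.1.le)
    ((hS.continuous_orbit g).neg.intervalIntegrable _ _)
  rw [intervalIntegral.integral_neg, hS.apply_zero] at h
  exact h.symm

lemma hasDerivAt_integral (hS : IsSemigroupOf G S) (g : H) (t : ℝ) :
    HasDerivAt (fun r => ∫ s in (0 : ℝ)..r, S (max s 0) g) (S (max t 0) g) t :=
  ((hS.continuous_orbit g).integral_hasStrictDerivAt 0 t).hasDerivAt

/-- The integrated form of the generator relation characterizes the graph. -/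
lemma mem_of_apply_sub_eq_integral (hS : IsSemigroupOf G S) {f g : H}
    (h : ∀ t : ℝ, 0 < t → S t f - f = -∫ s in (0 : ℝ)..t, S (max s 0) g) : (f, g) ∈ G := by
  rw [hS.generator]
  have h0 := (hS.hasDerivAt_integral g 0).neg.hasDerivWithinAt (s := Set.Ioi 0)
  rw [hasDerivWithinAt_iff_tendsto_slope' (by simp), max_self, hS.apply_zero] at h0
  refine h0.congr' ?_
  filter_upwards [self_mem_nhdsWithin] with s hs
  rw [h s hs]
  simp [slope]

lemma hasDerivAt (hS : IsSemigroupOf G S) {f g : H} (hfg : (f, g) ∈ G) {t : ℝ}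
    (ht : 0 < t) : HasDerivAt (fun s => S s f) (-(S t g)) t := by
  have h := (hS.hasDerivAt_integral g t).neg.const_add f
  rw [max_eq_left ht.le] at h
  refine h.congr_of_eventuallyEq ?_
  filter_upwards [lt_mem_nhds ht] with s hs
  rw [Pi.neg_apply, ← hS.apply_sub_eq_integral hfg hs.le]
  abel

lemma integral_mem (hS : IsSemigroupOf G S) (f : H) {t : ℝ} (ht : 0 ≤ t) :
    (∫ s in (0 : ℝ)..t, S (max s 0) f, f - S t f) ∈ G := by
  rw [hS.generator]
  have hi : ∀ a b, IntervalIntegrable (fun s => S (max s 0) f) volume a b := fun a b =>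
    (hS.continuous_orbit f).intervalIntegrable a b
  -- shifting the integration window leaves only its two ends
  have key : ∀ r : ℝ, 0 < r → S r (∫ s in (0 : ℝ)..t, S (max s 0) f) -
      (∫ s in (0 : ℝ)..t, S (max s 0) f) = (∫ s in (0 : ℝ)..(t + r), S (max s 0) f) -
      (∫ s in (0 : ℝ)..t, S (max s 0) f) - ∫ s in (0 : ℝ)..r, S (max s 0) f := by
    intro r hr
    have h1 : S r (∫ s in (0 : ℝ)..t, S (max s 0) f) =
        ∫ s in (0 : ℝ)..t, S (max (s + r) 0) f := by
      rw [← ContinuousLinearMap.intervalIntegral_comp_comm _ (hi 0 t)]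
      refine intervalIntegral.integral_congr fun s hs => ?_
      rw [Set.uIcc_of_le ht] at hs
      rw [max_eq_left hs.1, max_eq_left (by linarith [hs.1]), add_comm,
        hS.apply_add hr.le hs.1]
    rw [h1, intervalIntegral.integral_comp_add_right (fun s => S (max s 0) f), zero_add,
      ← intervalIntegral.integral_add_adjacent_intervals (hi 0 r) (hi r (t + r))]
    abel
  have d1 := (hS.hasDerivAt_integral f t).tendsto_slope_zero_right
  have d0 := (hS.hasDerivAt_integral f 0).tendsto_slope_zero_right
  have d := d1.sub d0
  rw [max_eq_left ht, max_self, hS.apply_zero] at d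
  rw [neg_sub]
  refine d.congr' ?_
  filter_upwards [self_mem_nhdsWithin] with r hr
  rw [key r hr, ← smul_sub]
  simp

/-- The domain of the generator is dense. -/
lemma exists_seq_tendsto (hS : IsSemigroupOf G S) (f : H) :
    ∃ p : ℕ → H × H, (∀ n, p n ∈ G) ∧ Tendsto (fun n => (p n).1) atTop (𝓝 f) := by
  set a : ℕ → ℝ := fun n => 1 / ((n : ℝ) + 1)
  have ha : ∀ n, 0 < a n := fun n => by positivity
  have hat : Tendsto a atTop (𝓝[>] 0) :=
    tendsto_nhdsWithin_iff.2 ⟨tendsto_one_div_add_atTop_nhds_zero_nat, .of_forall ha⟩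
  refine ⟨fun n => ((a n)⁻¹ • ∫ s in (0 : ℝ)..a n, S (max s 0) f,
    (a n)⁻¹ • (f - S (a n) f)), fun n => ?_, ?_⟩
  · have h := (hS.generator _ _).1 (hS.integral_mem f (ha n).le)
    rw [hS.generator]
    have := h.const_smul (a n)⁻¹
    rw [smul_neg] at this
    refine this.congr fun s => ?_
    simp only [map_smul]
    rw [← smul_sub, smul_comm]
  · have d := (hS.hasDerivAt_integral f 0).tendsto_slope_zero_right
    rw [max_self, hS.apply_zero] at d
    refine (d.comp hat).congr fun n => ?_
    simp

/-- The semigroup of a nonnegative operator consists of contractions. -/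
lemma norm_apply_le (hS : IsSemigroupOf G S) (hpos : ∀ f g, (f, g) ∈ G → 0 ≤ inner ℝ g f)
    {t : ℝ} (ht : 0 ≤ t) (f : H) : ‖S t f‖ ≤ ‖f‖ := by
  obtain ⟨p, hp, hlim⟩ := hS.exists_seq_tendsto f
  refine le_of_tendsto_of_tendsto' (((S t).continuous.tendsto f).comp hlim).norm hlim.norm
    fun n => ?_
  have hanti : AntitoneOn (fun s => ‖S s (p n).1‖ ^ 2) (Set.Ici 0) := by
    refine antitoneOn_of_hasDerivWithinAt_nonpos (convex_Ici 0)
      (((hS.cont _).norm).pow 2)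
      (f' := fun s => 2 * inner ℝ (S s (p n).1) (-(S s (p n).2))) (fun s hs => ?_) fun s hs => ?_
    · rw [interior_Ici] at hs ⊢
      exact (hS.hasDerivAt (hp n) hs).norm_sq.hasDerivWithinAt
    · rw [interior_Ici] at hs
      have := hpos _ _ (hS.map_mem (hp n) (le_of_lt hs))
      rw [inner_neg_right, real_inner_comm]
      linarith
  have := hanti (Set.mem_Ici.2 le_rfl) (Set.mem_Ici.2 ht) ht
  simp only [hS.apply_zero] at this
  exact (sq_le_sq₀ (norm_nonneg _) (norm_nonneg _)).1 this

/-- The generator is closed. -/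
lemma mem_of_tendsto (hS : IsSemigroupOf G S) (hpos : ∀ f g, (f, g) ∈ G → 0 ≤ inner ℝ g f)
    {p : ℕ → H × H} (hp : ∀ n, p n ∈ G) {f g : H} (hf : Tendsto (fun n => (p n).1) atTop (𝓝 f))
    (hg : Tendsto (fun n => (p n).2) atTop (𝓝 g)) : (f, g) ∈ G := by
  refine hS.mem_of_apply_sub_eq_integral fun t ht => ?_
  have h1 : Tendsto (fun n => S t (p n).1 - (p n).1) atTop (𝓝 (S t f - f)) :=
    (((S t).continuous.tendsto f).comp hf).sub hf
  have hi : ∀ g : H, IntervalIntegrable (fun s => S (max s 0) g) volume 0 t := fun g =>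
    (hS.continuous_orbit g).intervalIntegrable _ _
  have h2 : Tendsto (fun n => ∫ s in (0 : ℝ)..t, S (max s 0) (p n).2) atTop
      (𝓝 (∫ s in (0 : ℝ)..t, S (max s 0) g)) := by
    rw [tendsto_iff_norm_sub_tendsto_zero] at hg ⊢
    refine squeeze_zero (g := fun n => ‖(p n).2 - g‖ * |t - 0|) (fun _ => norm_nonneg _)
      (fun n => ?_) (by simpa using hg.mul_const |t - 0|)
    rw [← intervalIntegral.integral_sub (hi (p n).2) (hi g)]
    refine intervalIntegral.norm_integral_le_of_norm_le_const fun s _ => ?_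
    rw [← map_sub]
    exact hS.norm_apply_le hpos (le_max_right _ _) _
  refine tendsto_nhds_unique h1 (h2.neg.congr fun n => ?_)
  exact (hS.apply_sub_eq_integral (hp n) ht.le).symm

lemma inner_apply_comm (hS : IsSemigroupOf G S)
    (hsymm : ∀ f g f' g', (f, g) ∈ G → (f', g') ∈ G → inner ℝ g f' = inner ℝ f g')
    {t : ℝ} (ht : 0 ≤ t) (f f' : H) : inner ℝ (S t f) f' = inner ℝ f (S t f') := by
  obtain ⟨p, hp, hlim⟩ := hS.exists_seq_tendsto f
  obtain ⟨p', hp', hlim'⟩ := hS.exists_seq_tendsto f'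
  have hl : Tendsto (fun n => (inner ℝ (S t (p n).1) (p' n).1 : ℝ)) atTop _ :=
    (((S t).continuous.tendsto f).comp hlim).inner hlim'
  have hr : Tendsto (fun n => (inner ℝ (p n).1 (S t (p' n).1) : ℝ)) atTop _ :=
    hlim.inner (((S t).continuous.tendsto f').comp hlim')
  refine tendsto_nhds_unique hl (hr.congr fun n => ?_)
  -- `s ↦ ⟪S s f, S (t - s) f'⟫` is constant on `[0, t]`
  rcases ht.eq_or_lt with rfl | ht0
  · simp [hS.apply_zero]
  have hc : ContinuousOn (fun s => inner ℝ (S s (p n).1) (S (t - s) (p' n).1)) (Set.Icc 0 t) := by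
    refine ContinuousOn.inner ((hS.cont _).mono Set.Icc_subset_Ici_self) ?_
    exact (hS.cont _).comp (by fun_prop) fun s hs => sub_nonneg.2 hs.2
  have hd : ∀ s ∈ Set.Ioo 0 t,
      HasDerivAt (fun s => inner ℝ (S s (p n).1) (S (t - s) (p' n).1)) 0 s := by
    intro s hs
    have h1 := hS.hasDerivAt (hp n) hs.1
    have h2 := HasDerivAt.scomp s (hS.hasDerivAt (hp' n) (sub_pos.2 hs.2))
      ((hasDerivAt_id s).const_sub t)
    have h3 := h1.inner ℝ h2
    refine h3.congr_deriv ?_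
    have := hsymm _ _ _ _ (hS.map_mem (hp n) hs.1.le) (hS.map_mem (hp' n) (sub_pos.2 hs.2).le)
    simp only [Function.comp, neg_smul, one_smul, neg_neg, inner_neg_left]
    linarith
  obtain ⟨c, -, hc⟩ := exists_hasDerivAt_eq_slope _ _ ht0 hc hd
  rw [eq_div_iff (by linarith)] at hc
  simp only [sub_self, hS.apply_zero, sub_zero, zero_mul] at hc
  linarith

/-- Smoothing estimate for the analytic semigroup of a nonnegative symmetric operator. -/
lemma mul_norm_apply_le (hS : IsSemigroupOf G S)
    (hsymm : ∀ f g f' g', (f, g) ∈ G → (f', g') ∈ G → inner ℝ g f' = inner ℝ f g')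
    (hpos : ∀ f g, (f, g) ∈ G → 0 ≤ inner ℝ g f) {f g : H} (hfg : (f, g) ∈ G) {t : ℝ}
    (ht : 0 < t) : t * ‖S t g‖ ≤ ‖f‖ := by
  -- freezing the last norm at the final time `t` makes this functional differentiable
  have hanti : AntitoneOn (fun s => ‖S s f‖ ^ 2 + 2 * s * inner ℝ g (S (2 * s) f) +
      2 * s ^ 2 * ‖S t g‖ ^ 2) (Set.Icc 0 t) := by
    refine antitoneOn_of_hasDerivWithinAt_nonpos (convex_Icc 0 t) ?_
      (f' := fun s => 4 * s * (‖S t g‖ ^ 2 - ‖S s g‖ ^ 2)) (fun s hs => ?_) fun s hs => ?_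
    · have h1 : ContinuousOn (fun s => S s f) (Set.Icc 0 t) :=
        (hS.cont f).mono Set.Icc_subset_Ici_self
      have h2 : ContinuousOn (fun s => S (2 * s) f) (Set.Icc 0 t) :=
        (hS.cont f).comp (by fun_prop) fun s hs => by
          simpa using hs.1
      have h3 : ContinuousOn (fun s => inner ℝ g (S (2 * s) f)) (Set.Icc 0 t) :=
        continuousOn_const.inner h2
      fun_prop
    · rw [interior_Icc] at hs ⊢
      have h1 := (hS.hasDerivAt hfg hs.1).norm_sq
      have h2 := HasDerivAt.scomp s (hS.hasDerivAt hfg (t := 2 * s) (by linarith [hs.1]))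
        ((hasDerivAt_id s).const_mul 2)
      have h3 := (hasDerivAt_const s g).inner ℝ h2
      have h4 := ((hasDerivAt_id s).const_mul 2).mul h3
      have h5 := (((hasDerivAt_id s).pow 2).const_mul 2).mul_const (‖S t g‖ ^ 2)
      have e1 : inner ℝ g (S (2 * s) f) = inner ℝ (S s f) (S s g) := by
        rw [two_mul, hS.apply_add hs.1.le hs.1.le, real_inner_comm,
          hS.inner_apply_comm hsymm hs.1.le]
      have e2 : inner ℝ g (S (2 * s) g) = ‖S s g‖ ^ 2 := by
        rw [two_mul, hS.apply_add hs.1.le hs.1.le, ← hS.inner_apply_comm hsymm hs.1.le,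
          real_inner_self_eq_norm_sq]
      refine (((h1.add h4).add h5).congr_deriv ?_).hasDerivWithinAt
      simp only [Function.comp, id, inner_neg_right, inner_smul_right, inner_zero_left, e1, e2,
        mul_one, smul_neg]
      push_cast
      ring
    · rw [interior_Icc] at hs
      have h1 : ‖S t g‖ ≤ ‖S s g‖ := by
        have := hS.norm_apply_le hpos (sub_nonneg.2 hs.2.le) (S s g)
        rwa [← hS.apply_add (sub_nonneg.2 hs.2.le) hs.1.le, sub_add_cancel] at this
      have h2 : ‖S t g‖ ^ 2 ≤ ‖S s g‖ ^ 2 := by gcongr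
      exact mul_nonpos_of_nonneg_of_nonpos (by linarith [hs.1]) (by linarith)
  have h := hanti (Set.left_mem_Icc.2 ht.le) (Set.right_mem_Icc.2 ht.le) ht.le
  simp only [hS.apply_zero] at h
  have e1 : inner ℝ g (S (2 * t) f) = inner ℝ (S t g) (S t f) := by
    rw [two_mul, hS.apply_add ht.le ht.le, hS.inner_apply_comm hsymm ht.le]
  have h2 : 0 ≤ 2 * t * inner ℝ g (S (2 * t) f) := by
    rw [e1]
    exact mul_nonneg (by linarith) (hpos _ _ (hS.map_mem hfg ht.le))
  refine abs_le_of_sq_le_sq' ?_ (norm_nonneg _) |>.2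
  nlinarith [sq_nonneg ‖S t f‖, sq_nonneg (t * ‖S t g‖)]

/-- The semigroup of a nonnegative symmetric operator maps into its domain for `t > 0`. -/
lemma exists_mem_of_nonneg (hS : IsSemigroupOf G S)
    (hsymm : ∀ f g f' g', (f, g) ∈ G → (f', g') ∈ G → inner ℝ g f' = inner ℝ f g')
    (hpos : ∀ f g, (f, g) ∈ G → 0 ≤ inner ℝ g f) {t : ℝ} (ht : 0 < t) (f : H) :
    ∃ g, (S t f, g) ∈ G := by
  obtain ⟨p, hp, hlim⟩ := hS.exists_seq_tendsto f
  have hcau : CauchySeq fun n => S t (p n).2 := by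
    have h0 := hlim.cauchySeq
    rw [Metric.cauchySeq_iff] at h0 ⊢
    intro ε hε
    obtain ⟨N, hN⟩ := h0 (t * ε) (by positivity)
    refine ⟨N, fun m hm n hn => ?_⟩
    have h1 := hN m hm n hn
    rw [dist_eq_norm] at h1 ⊢
    have h2 := hS.mul_norm_apply_le hsymm hpos (hS.sub_mem (hp m) (hp n)) ht
    rw [map_sub] at h2
    exact lt_of_mul_lt_mul_left (h2.trans_lt h1) ht.le
  obtain ⟨g, hg⟩ := cauchySeq_tendsto_of_complete hcau
  exact ⟨g, hS.mem_of_tendsto hpos (p := fun n => (S t (p n).1, S t (p n).2))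
    (fun n => hS.map_mem (hp n) ht.le) (((S t).continuous.tendsto f).comp hlim) hg⟩

/-- The semigroup of a symmetric operator that is bounded below maps into the domain of that
operator for `t > 0`. -/
lemma exists_mem (hS : IsSemigroupOf G S) {c : ℝ}
    (hsymm : ∀ f g f' g', (f, g) ∈ G → (f', g') ∈ G → inner ℝ g f' = inner ℝ f g')
    (hlow : ∀ f g, (f, g) ∈ G → -c * ‖f‖ ^ 2 ≤ inner ℝ g f) {t : ℝ} (ht : 0 < t) (f : H) :
    ∃ g, (S t f, g) ∈ G := by
  have hsymm' : ∀ f g f' g', (f, g) ∈ {p : H × H | (p.1, p.2 - c • p.1) ∈ G} →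
      (f', g') ∈ {p : H × H | (p.1, p.2 - c • p.1) ∈ G} → inner ℝ g f' = inner ℝ f g' := by
    intro f g f' g' h h'
    have := hsymm _ _ _ _ h h'
    simp only [inner_sub_left, inner_sub_right, real_inner_smul_left, real_inner_smul_right]
      at this
    linarith
  have hpos' : ∀ f g, (f, g) ∈ {p : H × H | (p.1, p.2 - c • p.1) ∈ G} → 0 ≤ inner ℝ g f := by
    intro f g h
    have := hlow _ _ h
    simp only [inner_sub_left, real_inner_smul_left, real_inner_self_eq_norm_sq] at this
    linarith
  obtain ⟨g, hg⟩ := (hS.rescale c).exists_mem_of_nonneg hsymm' hpos' ht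
    (Real.exp (c * t) • f)
  have e : (Real.exp (-(c * t)) • S t) (Real.exp (c * t) • f) = S t f := by
    simp [smul_smul, ← Real.exp_add]
  rw [e] at hg
  exact ⟨_, hg⟩

lemma hasDerivAt_of_mem (hS : IsSemigroupOf G S) {c : ℝ}
    (hsymm : ∀ f g f' g', (f, g) ∈ G → (f', g') ∈ G → inner ℝ g f' = inner ℝ f g')
    (hlow : ∀ f g, (f, g) ∈ G → -c * ‖f‖ ^ 2 ≤ inner ℝ g f) {t : ℝ} (ht : 0 < t) {f g : H}
    (hg : (S t f, g) ∈ G) : HasDerivAt (fun s => S s f) (-g) t := by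
  obtain ⟨g', hg'⟩ := hS.exists_mem hsymm hlow (half_pos ht) f
  have h := hS.hasDerivAt hg' (half_pos ht)
  have hm := hS.map_mem hg' (half_pos ht).le
  rw [← hS.apply_add (half_pos ht).le (half_pos ht).le, add_halves] at hm
  have hgg : g = S (t / 2) g' := neg_injective <|
    tendsto_nhds_unique ((hS.generator _ _).1 hg) ((hS.generator _ _).1 hm)
  rw [hgg]
  have h2 := HasDerivAt.scomp t (g₁ := fun s => S s (S (t / 2) f)) (h := fun s => s - t / 2)
    (by rw [sub_half]; exact h)
    ((hasDerivAt_id t).sub_const (t / 2))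
  rw [one_smul] at h2
  refine h2.congr_of_eventuallyEq ?_
  filter_upwards [lt_mem_nhds (half_lt_self ht)] with s hs
  simp only [Function.comp]
  rw [← hS.apply_add (sub_pos.2 hs).le (half_pos ht).le, sub_add_cancel]

/-- Backward uniqueness for symmetric semigroups: `‖S (t/2) f‖² = ⟪S t f, f⟫` lets a zero at time
`t` propagate to the times `t / 2 ^ n`. -/
lemma apply_ne_zero (hS : IsSemigroupOf G S)
    (hsymm : ∀ f g f' g', (f, g) ∈ G → (f', g') ∈ G → inner ℝ g f' = inner ℝ f g')
    {t : ℝ} (ht : 0 ≤ t) {f : H} (hf : f ≠ 0) : S t f ≠ 0 := by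
  intro h0
  have hn : ∀ n : ℕ, S (t * (1 / 2) ^ n) f = 0 := by
    intro n
    induction n with
    | zero => simpa using h0
    | succ n ih =>
      have hp : 0 ≤ t * (1 / 2) ^ (n + 1) := by positivity
      rw [← inner_self_eq_zero (𝕜 := ℝ), hS.inner_apply_comm hsymm hp, ← hS.apply_add hp hp,
        show t * (1 / 2) ^ (n + 1) + t * (1 / 2) ^ (n + 1) = t * (1 / 2) ^ n by ring, ih,
        inner_zero_right]
  have hlim : Tendsto (fun n : ℕ => S (t * (1 / 2) ^ n) f) atTop (𝓝 (S 0 f)) := by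
    refine ((hS.cont f) 0 (Set.mem_Ici.2 le_rfl)).tendsto.comp
      (tendsto_nhdsWithin_iff.2 ⟨?_, .of_forall fun n => ?_⟩)
    · simpa using (tendsto_pow_atTop_nhds_zero_of_lt_one (r := (1 / 2 : ℝ)) (by norm_num)
        (by norm_num)).const_mul t
    · exact Set.mem_Ici.2 (by positivity)
  simp only [hn, hS.apply_zero] at hlim
  exact hf (tendsto_nhds_unique hlim tendsto_const_nhds)

end IsSemigroupOf

/-! ### The space `W^{α/2,2}` and its form -/

section Form

variable {d : ℕ} {α : ℝ} {Ω : Set (Rd d)} {f g h : Rd d → ℝ}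

lemma constA_pos (hd : 0 < (d : ℝ)) (h0 : 0 < α) (h2 : α < 2) : 0 < constA d α := by
  have h1 : 0 < Real.Gamma ((d + α) / 2) := Real.Gamma_pos_of_pos (by linarith)
  have h3 : 0 < Real.Gamma (1 - α / 2) := Real.Gamma_pos_of_pos (by linarith)
  have := Real.pi_pos
  unfold constA
  positivity

lemma aestronglyMeasurable_sub_fst_snd (hf : AEStronglyMeasurable f volume) :
    AEStronglyMeasurable (fun p : Rd d × Rd d => f p.1 - f p.2)
      ((volume : Measure (Rd d)).prod volume) :=
  hf.comp_fst.sub hf.comp_snd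

lemma aestronglyMeasurable_kernel :
    AEStronglyMeasurable (fun p : Rd d × Rd d => ‖p.1 - p.2‖ ^ ((d : ℝ) + α))
      ((volume : Measure (Rd d)).prod volume) :=
  ((measurable_fst.sub measurable_snd).norm.pow_const _).aestronglyMeasurable

lemma ae_prod_of_ae {P : Rd d → Prop} (hP : ∀ᵐ x ∂(volume : Measure (Rd d)), P x) :
    ∀ᵐ p ∂((volume : Measure (Rd d)).prod (volume : Measure (Rd d))), P p.1 ∧ P p.2 :=
  (Measure.quasiMeasurePreserving_fst.ae hP).and (Measure.quasiMeasurePreserving_snd.ae hP)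

/-- A function whose squared differences are controlled by those of elements of `W^{α/2,2}` is
itself in `W^{α/2,2}`. -/
lemma MemW.of_sq_sub_le (hf : MemW α f) (hg : MemW α g) (hh : MemLp h 2 volume) (a b : ℝ)
    {P : Rd d → Prop} (hP : ∀ᵐ x ∂(volume : Measure (Rd d)), P x)
    (hle : ∀ x y, P x → P y → (h x - h y) ^ 2 ≤ a * (f x - f y) ^ 2 + b * (g x - g y) ^ 2) :
    MemW α h := by
  refine ⟨hh, ((hf.2.const_mul a).add (hg.2.const_mul b)).mono' ?_ ?_⟩
  · exact ((aestronglyMeasurable_sub_fst_snd hh.1).pow 2).div₀ aestronglyMeasurable_kernel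
  · filter_upwards [ae_prod_of_ae hP] with p hp
    have hk : 0 ≤ ‖p.1 - p.2‖ ^ ((d : ℝ) + α) := by positivity
    rw [Real.norm_of_nonneg (by positivity), Pi.add_apply, ← mul_div_assoc, ← mul_div_assoc,
      ← add_div]
    exact div_le_div_of_nonneg_right (hle _ _ hp.1 hp.2) hk

lemma MemW.congr (hf : MemW α f) (hfg : f =ᵐ[volume] g) : MemW α g :=
  hf.of_sq_sub_le hf (hf.1.ae_eq hfg) 1 0 hfg fun x y hx hy => by rw [hx, hy]; linarith

lemma MemW.sub (hf : MemW α f) (hg : MemW α g) : MemW α (fun x => f x - g x) :=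
  hf.of_sq_sub_le hg (hf.1.sub hg.1) 2 2 (.of_forall fun _ => trivial) fun x y _ _ => by
    nlinarith [sq_nonneg ((f x - f y) + (g x - g y))]

lemma MemW.const_mul (hf : MemW α f) (c : ℝ) : MemW α (fun x => c * f x) :=
  hf.of_sq_sub_le hf (hf.1.const_mul c) (c ^ 2) 0 (.of_forall fun _ => trivial)
    fun x y _ _ => by nlinarith

lemma MemW.max_zero (hf : MemW α f) : MemW α (fun x => max (f x) 0) :=
  hf.of_sq_sub_le hf hf.1.pos_part 1 0 (.of_forall fun _ => trivial) fun x y _ _ => by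
    rw [one_mul, zero_mul, add_zero]
    exact sq_le_sq.2 (abs_max_sub_max_le_abs _ _ _)

lemma MemW0.congr (hf : MemW0 α Ω f) (hfg : f =ᵐ[volume] g) : MemW0 α Ω g :=
  ⟨hf.1.congr hfg, by filter_upwards [hf.2, hfg] with x h1 h2 hx; rw [← h2, h1 hx]⟩

lemma MemW0.sub (hf : MemW0 α Ω f) (hg : MemW0 α Ω g) : MemW0 α Ω (fun x => f x - g x) :=
  ⟨hf.1.sub hg.1, by filter_upwards [hf.2, hg.2] with x h1 h2 hx; rw [h1 hx, h2 hx, sub_zero]⟩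

lemma MemW0.const_mul (hf : MemW0 α Ω f) (c : ℝ) : MemW0 α Ω (fun x => c * f x) :=
  ⟨hf.1.const_mul c, by filter_upwards [hf.2] with x h1 hx; rw [h1 hx, mul_zero]⟩

lemma MemW0.max_zero (hf : MemW0 α Ω f) : MemW0 α Ω (fun x => max (f x) 0) :=
  ⟨hf.1.max_zero, by filter_upwards [hf.2] with x h1 hx; rw [h1 hx, max_self]⟩

lemma MemW0.integrable (hΩ : IsOpen Ω) (hΩb : Bornology.IsBounded Ω) (hf : MemW0 α Ω f) :
    Integrable f volume := by
  have : IsFiniteMeasure (volume.restrict Ω) := ⟨by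
    rw [Measure.restrict_apply_univ]; exact hΩb.measure_lt_top⟩
  have h1 : IntegrableOn f Ω := hf.1.1.restrict Ω |>.integrable (by norm_num)
  refine ((integrable_indicator_iff hΩ.measurableSet).2 h1).congr ?_
  filter_upwards [hf.2] with x hx
  by_cases hxΩ : x ∈ Ω
  · simp [hxΩ]
  · simp [hxΩ, hx hxΩ]

lemma integrable_energy (hf : MemW α f) (hg : MemW α g) :
    Integrable (fun p : Rd d × Rd d =>
      (f p.1 - f p.2) * (g p.1 - g p.2) / ‖p.1 - p.2‖ ^ ((d : ℝ) + α))
      ((volume : Measure (Rd d)).prod (volume : Measure (Rd d))) := by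
  refine (hf.2.add hg.2).mono' ?_ (.of_forall fun p => ?_)
  · exact ((aestronglyMeasurable_sub_fst_snd hf.1.1).mul
      (aestronglyMeasurable_sub_fst_snd hg.1.1)).div₀ aestronglyMeasurable_kernel
  · have hk : 0 ≤ ‖p.1 - p.2‖ ^ ((d : ℝ) + α) := by positivity
    rw [norm_div, Real.norm_of_nonneg hk, Pi.add_apply, ← add_div]
    refine div_le_div_of_nonneg_right ?_ hk
    rw [Real.norm_eq_abs, abs_le]
    constructor <;> nlinarith [sq_nonneg ((f p.1 - f p.2) + (g p.1 - g p.2)),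
      sq_nonneg ((f p.1 - f p.2) - (g p.1 - g p.2)), sq_nonneg (f p.1 - f p.2),
      sq_nonneg (g p.1 - g p.2)]

lemma energy_comm (f g : Rd d → ℝ) : energy α f g = energy α g f := by
  simp only [energy, mul_comm (f _ - f _)]

lemma energy_congr {f' g' : Rd d → ℝ} (hf : f =ᵐ[volume] f') (hg : g =ᵐ[volume] g') :
    energy α f g = energy α f' g' := by
  unfold energy
  congr 1
  refine integral_congr_ae ?_
  filter_upwards [ae_prod_of_ae hf, ae_prod_of_ae hg] with p h1 h2
  rw [h1.1, h1.2, h2.1, h2.2]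

lemma energy_sub_left (hf : MemW α f) (hg : MemW α g) (hh : MemW α h) :
    energy α (fun x => f x - g x) h = energy α f h - energy α g h := by
  unfold energy
  rw [← mul_sub, ← integral_sub (integrable_energy hf hh) (integrable_energy hg hh)]
  congr 1
  refine integral_congr_ae (.of_forall fun p => ?_)
  ring

lemma energy_const_mul_left (c : ℝ) (f g : Rd d → ℝ) :
    energy α (fun x => c * f x) g = c * energy α f g := by
  unfold energy
  rw [mul_left_comm, ← integral_const_mul c]
  congr 1
  refine integral_congr_ae (.of_forall fun p => ?_)
  ring

lemma energy_zero_left (g : Rd d → ℝ) : energy α (fun _ => 0) g = 0 := by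
  simp [energy]

lemma energy_self_nonneg (hA : 0 ≤ constA d α) (f : Rd d → ℝ) : 0 ≤ energy α f f := by
  unfold energy
  refine mul_nonneg (by linarith) (integral_nonneg fun p => ?_)
  exact div_nonneg (mul_self_nonneg _) (by positivity)

lemma energy_le_energy (hA : 0 ≤ constA d α) {f' g' : Rd d → ℝ} (hf : MemW α f) (hg : MemW α g)
    (hf' : MemW α f') (hg' : MemW α g') {P : Rd d → Prop}
    (hP : ∀ᵐ x ∂(volume : Measure (Rd d)), P x)
    (hle : ∀ x y, P x → P y → (f x - f y) * (g x - g y) ≤ (f' x - f' y) * (g' x - g' y)) :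
    energy α f g ≤ energy α f' g' := by
  unfold energy
  refine mul_le_mul_of_nonneg_left ?_ (by linarith)
  refine integral_mono_ae (integrable_energy hf hg) (integrable_energy hf' hg') ?_
  filter_upwards [ae_prod_of_ae hP] with p hp
  exact div_le_div_of_nonneg_right (hle _ _ hp.1 hp.2) (by positivity)

/-- On a bounded set the kernel is bounded below, so that the interaction of the positive part of
`w` with its negative part is controlled by the product of their masses. -/
lemma exists_mul_integral_le_energy (hd : 0 < (d : ℝ)) (h0 : 0 < α) (h2 : α < 2)
    (hΩ : IsOpen Ω) (hΩb : Bornology.IsBounded Ω) :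
    ∃ c : ℝ, 0 < c ∧ ∀ w : Rd d → ℝ, MemW0 α Ω w →
      c * ((∫ x, max (w x) 0) * ∫ x, max (-w x) 0) ≤ energy α w (fun x => max (w x) 0) := by
  have hA := constA_pos hd h0 h2
  obtain ⟨D, hD0, hD⟩ : ∃ D : ℝ, 0 < D ∧ ∀ x ∈ Ω, ∀ y ∈ Ω, ‖x - y‖ ≤ D := by
    obtain ⟨D, hD⟩ := Metric.isBounded_iff.1 hΩb
    refine ⟨max D 1, by positivity, fun x hx y hy => ?_⟩
    rw [← dist_eq_norm]
    exact (hD hx hy).trans (le_max_left _ _)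
  set c0 : ℝ := (D ^ ((d : ℝ) + α))⁻¹
  have hc0 : 0 < c0 := by positivity
  refine ⟨constA d α * c0, by positivity, fun w hw => ?_⟩
  have hp := hw.max_zero
  have hn : MemW0 α Ω (fun x => max (-w x) 0) := by
    have := (hw.const_mul (-1)).max_zero
    simpa using this
  have ip := hp.integrable hΩ hΩb
  have iN := hn.integrable hΩ hΩb
  have i1 := ip.mul_prod iN
  have i2 := iN.mul_prod ip
  have key : ∫ p : Rd d × Rd d, c0 * (max (w p.1) 0 * max (-w p.2) 0 +
      max (-w p.1) 0 * max (w p.2) 0) ∂((volume : Measure (Rd d)).prod volume) ≤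
      ∫ p : Rd d × Rd d, (w p.1 - w p.2) * (max (w p.1) 0 - max (w p.2) 0) /
        ‖p.1 - p.2‖ ^ ((d : ℝ) + α) ∂((volume : Measure (Rd d)).prod volume) := by
    refine integral_mono_ae ((i1.add i2).const_mul c0) (integrable_energy hw.1 hp.1) ?_
    filter_upwards [ae_prod_of_ae hw.2] with p hp
    have h1 : max (w p.1) 0 * max (-w p.2) 0 + max (-w p.1) 0 * max (w p.2) 0 ≤
        (w p.1 - w p.2) * (max (w p.1) 0 - max (w p.2) 0) := by
      rcases le_total (w p.1) 0 with h1 | h1 <;> rcases le_total (w p.2) 0 with h2 | h2 <;>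
        simp [h1, h2] <;> nlinarith
    rcases eq_or_ne (max (w p.1) 0 * max (-w p.2) 0 + max (-w p.1) 0 * max (w p.2) 0) 0
      with h3 | h3
    · rw [h3] at h1 ⊢
      rw [mul_zero]
      exact div_nonneg h1 (by positivity)
    -- off the diagonal, and with both points in `Ω`, the kernel is at least `c0`
    have hx1 : p.1 ∈ Ω := by
      by_contra hx; exact h3 (by simp [hp.1 hx])
    have hx2 : p.2 ∈ Ω := by
      by_contra hx; exact h3 (by simp [hp.2 hx])
    have hne : p.1 ≠ p.2 := by
      intro he
      apply h3
      rw [he]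
      rcases le_total (w p.2) 0 with h2 | h2 <;> simp [h2]
    have hpos : 0 < ‖p.1 - p.2‖ := norm_pos_iff.2 (sub_ne_zero.2 hne)
    have hk : c0 ≤ (‖p.1 - p.2‖ ^ ((d : ℝ) + α))⁻¹ :=
      inv_anti₀ (by positivity)
        (Real.rpow_le_rpow hpos.le (hD _ hx1 _ hx2) (by linarith))
    rw [div_eq_mul_inv, mul_comm c0]
    exact mul_le_mul h1 hk hc0.le (le_trans (by positivity) h1)
  rw [integral_const_mul, integral_add i1 i2,
    integral_prod_mul (fun x => max (w x) 0) (fun x => max (-w x) 0),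
    integral_prod_mul (fun x => max (-w x) 0) (fun x => max (w x) 0)] at key
  unfold energy
  have := mul_le_mul_of_nonneg_left key (show 0 ≤ 1 / 2 * constA d α by positivity)
  refine le_trans (le_of_eq ?_) this
  ring

end Form

/-! ### Quadratic bumps -/

section Bump

variable {d : ℕ} {α : ℝ} {Ω : Set (Rd d)}

/-- The function `(r² - |x - x₀|²)₊`. It is semiconvex, which is all the regularity needed to bound
its fractional Laplacian from above, also for `α ≥ 1`. -/
noncomputable def bump (x₀ : Rd d) (r : ℝ) (x : Rd d) : ℝ := max (r ^ 2 - ‖x - x₀‖ ^ 2) 0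

lemma bump_nonneg (x₀ : Rd d) (r : ℝ) (x : Rd d) : 0 ≤ bump x₀ r x := le_max_right _ _

lemma bump_le (x₀ : Rd d) (r : ℝ) (x : Rd d) : bump x₀ r x ≤ r ^ 2 :=
  max_le (by linarith [sq_nonneg ‖x - x₀‖]) (sq_nonneg r)

lemma continuous_bump (x₀ : Rd d) (r : ℝ) : Continuous (bump x₀ r) := by
  unfold bump; fun_prop

lemma bump_eq_zero {x₀ : Rd d} {r : ℝ} (hr : 0 ≤ r) {x : Rd d}
    (hx : x ∉ Metric.closedBall x₀ r) : bump x₀ r x = 0 := by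
  rw [Metric.mem_closedBall, dist_eq_norm, not_le] at hx
  refine max_eq_right ?_
  nlinarith

/-- One-sided bound on second differences. -/
lemma bump_second_difference_le (x₀ : Rd d) (r : ℝ) (x z : Rd d) :
    2 * bump x₀ r x - bump x₀ r (x + z) - bump x₀ r (x - z) ≤
      (2 + 2 * r ^ 2) * min (‖z‖ ^ 2) 1 := by
  have h1 : 2 * bump x₀ r x - bump x₀ r (x + z) - bump x₀ r (x - z) ≤ 2 * ‖z‖ ^ 2 := by
    have hp := parallelogram_law_with_norm ℝ (x - x₀) z
    have e1 : x + z - x₀ = x - x₀ + z := by abel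
    have e2 : x - z - x₀ = x - x₀ - z := by abel
    unfold bump
    rw [e1, e2]
    have a1 := le_max_left (r ^ 2 - ‖x - x₀ + z‖ ^ 2) 0
    have a2 := le_max_left (r ^ 2 - ‖x - x₀ - z‖ ^ 2) 0
    have b1 := le_max_right (r ^ 2 - ‖x - x₀ + z‖ ^ 2) 0
    have b2 := le_max_right (r ^ 2 - ‖x - x₀ - z‖ ^ 2) 0
    rcases max_cases (r ^ 2 - ‖x - x₀‖ ^ 2) 0 with ⟨h, -⟩ | ⟨h, -⟩ <;> rw [h]
    · nlinarith
    · nlinarith [sq_nonneg ‖z‖]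
  have h2 : 2 * bump x₀ r x - bump x₀ r (x + z) - bump x₀ r (x - z) ≤ 2 * r ^ 2 := by
    linarith [bump_nonneg x₀ r (x + z), bump_nonneg x₀ r (x - z), bump_le x₀ r x]
  rcases le_total (‖z‖ ^ 2) 1 with h | h
  · rw [min_eq_left h]
    nlinarith [mul_nonneg (sq_nonneg r) (sq_nonneg ‖z‖)]
  · rw [min_eq_right h]
    linarith

lemma sq_bump_sub_le {x₀ : Rd d} {r : ℝ} (hr : 0 ≤ r) (x y : Rd d) :
    (bump x₀ r x - bump x₀ r y) ^ 2 ≤ (4 * r ^ 2 + r ^ 4) * min (‖x - y‖ ^ 2) 1 := by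
  have h1 : (bump x₀ r x - bump x₀ r y) ^ 2 ≤ r ^ 4 := by
    have := sq_le_sq' (a := bump x₀ r x - bump x₀ r y) (b := r ^ 2)
      (by linarith [bump_nonneg x₀ r x, bump_le x₀ r y])
      (by linarith [bump_nonneg x₀ r y, bump_le x₀ r x])
    nlinarith
  -- `s ↦ (r² - s²)₊` is Lipschitz with constant `2 r` on `[0, ∞)`
  have lip : ∀ a b : ℝ, 0 ≤ a → 0 ≤ b → max (r ^ 2 - a ^ 2) 0 - max (r ^ 2 - b ^ 2) 0 ≤
      2 * r * |a - b| := by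
    intro a b ha hb
    have hab := neg_abs_le (a - b)
    have hab0 := abs_nonneg (a - b)
    rcases le_total r a with h | h
    · rw [max_eq_right (a := r ^ 2 - a ^ 2) (by nlinarith)]
      nlinarith [le_max_right (r ^ 2 - b ^ 2) 0, mul_nonneg hr hab0]
    · rw [max_eq_left (a := r ^ 2 - a ^ 2) (by nlinarith)]
      rcases le_total r b with h' | h'
      · have e : r ^ 2 - a ^ 2 ≤ 2 * r * (r - a) := by nlinarith
        have e' : 2 * r * (r - a) ≤ 2 * r * |a - b| := by
          apply mul_le_mul_of_nonneg_left _ (by linarith); linarith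
        linarith [le_max_right (r ^ 2 - b ^ 2) 0]
      · have e : (b - a) * (b + a) ≤ |a - b| * (2 * r) :=
          mul_le_mul (by linarith) (by linarith) (by linarith) hab0
        nlinarith [le_max_left (r ^ 2 - b ^ 2) 0]
  have hl : |bump x₀ r x - bump x₀ r y| ≤ 2 * r * ‖x - y‖ := by
    have hn : |‖x - x₀‖ - ‖y - x₀‖| ≤ ‖x - y‖ := by
      have := abs_norm_sub_norm_le (x - x₀) (y - x₀)
      rwa [sub_sub_sub_cancel_right] at this
    have hn' : 2 * r * |‖x - x₀‖ - ‖y - x₀‖| ≤ 2 * r * ‖x - y‖ :=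
      mul_le_mul_of_nonneg_left hn (by linarith)
    have l1 := lip _ _ (norm_nonneg (x - x₀)) (norm_nonneg (y - x₀))
    have l2 := lip _ _ (norm_nonneg (y - x₀)) (norm_nonneg (x - x₀))
    rw [abs_sub_comm ‖y - x₀‖] at l2
    unfold bump
    rw [abs_le]
    constructor <;> linarith
  have h2 : (bump x₀ r x - bump x₀ r y) ^ 2 ≤ 4 * r ^ 2 * ‖x - y‖ ^ 2 := by
    rw [← sq_abs]
    have := pow_le_pow_left₀ (abs_nonneg _) hl 2
    nlinarith
  rcases le_total (‖x - y‖ ^ 2) 1 with h | h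
  · rw [min_eq_left h]
    nlinarith [mul_nonneg (sq_nonneg (r ^ 2)) (sq_nonneg ‖x - y‖)]
  · rw [min_eq_right h]
    nlinarith [sq_nonneg r]

/-- The Lévy integrability condition for the kernel. -/
lemma integrable_min_sq_div (hd : 0 < d) (h0 : 0 < α) (h2 : α < 2) :
    Integrable (fun z : Rd d => min (‖z‖ ^ 2) 1 / ‖z‖ ^ ((d : ℝ) + α)) volume := by
  have : Nonempty (Fin d) := ⟨⟨0, hd⟩⟩
  have : Nontrivial (Rd d) := inferInstance
  rw [integrable_fun_norm_addHaar volume (f := fun s : ℝ => min (s ^ 2) 1 / s ^ ((d : ℝ) + α)),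
    finrank_euclideanSpace_fin, ← Set.Ioc_union_Ioi_eq_Ioi zero_le_one]
  have hpow : ∀ s : ℝ, 0 < s → s ^ (d - 1) = s ^ ((d : ℝ) - 1) := by
    intro s hs
    rw [← Real.rpow_natCast, Nat.cast_sub hd, Nat.cast_one]
  refine IntegrableOn.union ?_ ?_
  · have h := (intervalIntegral.intervalIntegrable_rpow' (a := 0) (b := 1) (r := 1 - α)
      (by linarith)).1
    refine h.congr_fun (fun s hs => ?_) measurableSet_Ioc
    have hs0 : 0 < s := hs.1
    simp only [smul_eq_mul]
    rw [min_eq_left (pow_le_one₀ hs0.le hs.2), hpow s hs0, ← Real.rpow_natCast s 2,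
      ← Real.rpow_sub hs0, ← Real.rpow_add hs0]
    congr 1
    push_cast
    ring
  · have h := integrableOn_Ioi_rpow_of_lt (a := -1 - α) (c := 1) (by linarith) one_pos
    refine h.congr_fun (fun s hs => ?_) measurableSet_Ioi
    have hs1 : 1 < s := hs
    have hs0 : 0 < s := by linarith
    simp only [smul_eq_mul]
    rw [min_eq_right (one_le_pow₀ hs1.le), hpow s hs0, one_div, ← Real.rpow_neg hs0.le,
      ← Real.rpow_add hs0]
    congr 1
    ring

lemma measurePreserving_shear : MeasurePreserving (MeasurableEquiv.shearAddRight (Rd d))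
    ((volume : Measure (Rd d)).prod volume) ((volume : Measure (Rd d)).prod volume) :=
  measurePreserving_prod_add volume volume

lemma memW0_bump (hd : 0 < d) (h0 : 0 < α) (h2 : α < 2) {x₀ : Rd d} {r : ℝ} (hr : 0 ≤ r)
    (hB : Metric.closedBall x₀ r ⊆ Ω) : MemW0 α Ω (bump x₀ r) := by
  have hfin : volume (Metric.closedBall x₀ r) < ⊤ := measure_closedBall_lt_top
  have hmB : MeasurableSet (Metric.closedBall x₀ r) := Metric.isClosed_closedBall.measurableSet
  set J : Rd d → ℝ := fun z => min (‖z‖ ^ 2) 1 / ‖z‖ ^ ((d : ℝ) + α) with hJ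
  have hJ0 : ∀ z, 0 ≤ J z := fun z => by positivity
  have hJneg : ∀ z, J (-z) = J z := fun z => by simp [hJ]
  have iB : Integrable ((Metric.closedBall x₀ r).indicator fun _ => (1 : ℝ)) volume :=
    (integrable_indicator_iff hmB).2 (integrableOn_const hfin.ne)
  have i1 : Integrable (fun p : Rd d × Rd d =>
      (Metric.closedBall x₀ r).indicator (fun _ => (1 : ℝ)) p.1 * J (p.1 - p.2))
      ((volume : Measure (Rd d)).prod volume) := by
    rw [← measurePreserving_shear.integrable_comp_emb
      (MeasurableEquiv.shearAddRight (Rd d)).measurableEmbedding]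
    refine (iB.mul_prod (integrable_min_sq_div hd h0 h2)).congr (.of_forall fun p => ?_)
    change _ = _ * J (p.1 - (p.1 + p.2))
    rw [sub_add_cancel_left, hJneg]
    rfl
  have i2 := i1.swap
  refine ⟨⟨?_, ?_⟩, .of_forall fun x hx => bump_eq_zero hr fun h => hx (hB h)⟩
  · refine MemLp.ae_eq (f := (Metric.closedBall x₀ r).indicator (bump x₀ r)) ?_ ?_
    · refine .of_forall fun x => ?_
      by_cases hx : x ∈ Metric.closedBall x₀ r
      · simp [hx]
      · simp [hx, bump_eq_zero hr hx]
    · rw [memLp_indicator_iff_restrict hmB]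
      have : IsFiniteMeasure (volume.restrict (Metric.closedBall x₀ r)) := ⟨by
        rwa [Measure.restrict_apply_univ]⟩
      refine MemLp.of_bound (continuous_bump x₀ r).aestronglyMeasurable (r ^ 2)
        (.of_forall fun x => ?_)
      rw [Real.norm_of_nonneg (bump_nonneg _ _ _)]
      exact bump_le _ _ _
  · refine ((i1.add i2).const_mul (4 * r ^ 2 + r ^ 4)).mono' ?_ (.of_forall fun p => ?_)
    · exact ((aestronglyMeasurable_sub_fst_snd
        (continuous_bump x₀ r).aestronglyMeasurable).pow 2).div₀ aestronglyMeasurable_kernel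
    · have hk : 0 ≤ ‖p.1 - p.2‖ ^ ((d : ℝ) + α) := by positivity
      have hC : 0 ≤ 4 * r ^ 2 + r ^ 4 := by positivity
      rw [Real.norm_of_nonneg (by positivity)]
      simp only [Pi.add_apply, Function.comp, Prod.fst_swap, Prod.snd_swap]
      rw [← neg_sub p.1 p.2, hJneg, ← add_mul]
      by_cases hz : p.1 ∉ Metric.closedBall x₀ r ∧ p.2 ∉ Metric.closedBall x₀ r
      · rw [bump_eq_zero hr hz.1, bump_eq_zero hr hz.2]
        simp [hz.1, hz.2]
      · have h1 : 1 ≤ (Metric.closedBall x₀ r).indicator (fun _ => (1 : ℝ)) p.1 +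
            (Metric.closedBall x₀ r).indicator (fun _ => (1 : ℝ)) p.2 := by
          have n1 : ∀ x, 0 ≤ (Metric.closedBall x₀ r).indicator (fun _ => (1 : ℝ)) x :=
            fun x => Set.indicator_nonneg (fun _ _ => zero_le_one) x
          rw [not_and_or, not_not, not_not] at hz
          rcases hz with hz | hz
          · have := n1 p.2
            rw [Set.indicator_of_mem hz]
            linarith
          · have := n1 p.1
            rw [Set.indicator_of_mem hz]
            linarith
        calc (bump x₀ r p.1 - bump x₀ r p.2) ^ 2 / ‖p.1 - p.2‖ ^ ((d : ℝ) + α)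
            ≤ (4 * r ^ 2 + r ^ 4) * min (‖p.1 - p.2‖ ^ 2) 1 / ‖p.1 - p.2‖ ^ ((d : ℝ) + α) :=
              div_le_div_of_nonneg_right (sq_bump_sub_le hr _ _) hk
          _ = (4 * r ^ 2 + r ^ 4) * (1 * J (p.1 - p.2)) := by rw [hJ]; ring
          _ ≤ _ := mul_le_mul_of_nonneg_left (mul_le_mul_of_nonneg_right h1 (hJ0 _)) hC

/-- The fractional Laplacian of a bump is bounded above, in the weak sense. After the substitution
`(x, y) = (x, x + z)`, integrating over `x` first turns the form into second differences. -/
lemma exists_energy_bump_le (hd : 0 < d) (h0 : 0 < α) (h2 : α < 2) (hΩ : IsOpen Ω)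
    (hΩb : Bornology.IsBounded Ω) {x₀ : Rd d} {r : ℝ} (hr : 0 ≤ r)
    (hB : Metric.closedBall x₀ r ⊆ Ω) :
    ∃ C : ℝ, 0 ≤ C ∧ ∀ g : Rd d → ℝ, MemW0 α Ω g → (∀ x, 0 ≤ g x) →
      energy α (bump x₀ r) g ≤ C * ∫ x, g x := by
  have hA := constA_pos (Nat.cast_pos.2 hd) h0 h2
  have hψ := memW0_bump hd h0 h2 hr hB
  set ψ := bump x₀ r with hψdef
  set J : Rd d → ℝ := fun z => min (‖z‖ ^ 2) 1 / ‖z‖ ^ ((d : ℝ) + α) with hJ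
  have hJ0 : ∀ z, 0 ≤ J z := fun z => by positivity
  have hJi : Integrable J volume := integrable_min_sq_div hd h0 h2
  refine ⟨1 / 2 * constA d α * ((2 + 2 * r ^ 2) * ∫ z, J z), ?_, fun g hg hg0 => ?_⟩
  · have : 0 ≤ ∫ z, J z := integral_nonneg hJ0
    positivity
  have ig := hg.integrable hΩ hΩb
  have hψb : ∀ x, ‖ψ x‖ ≤ r ^ 2 := fun x => by
    rw [Real.norm_of_nonneg (bump_nonneg _ _ _)]; exact bump_le _ _ _
  have inner_le : ∀ z : Rd d, ∫ x, (ψ x - ψ (x + z)) * (g x - g (x + z)) ≤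
      (2 + 2 * r ^ 2) * min (‖z‖ ^ 2) 1 * ∫ x, g x := by
    intro z
    have hcψ : Continuous ψ := continuous_bump x₀ r
    have ia : ∀ a b : Rd d, Integrable (fun x => (ψ (x + a) - ψ (x + b)) * g x) volume := by
      intro a b
      refine ig.bdd_mul (c := r ^ 2 + r ^ 2) (by fun_prop) (.of_forall fun x => ?_)
      exact (norm_sub_le _ _).trans (add_le_add (hψb _) (hψb _))
    have i1 : Integrable (fun x => (ψ x - ψ (x + z)) * g x) volume := by
      simpa using ia 0 z
    have i2 : Integrable (fun x => (ψ (x - z) - ψ x) * g x) volume := by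
      simpa [sub_eq_add_neg] using ia (-z) 0
    have e2 : ∀ x, (ψ x - ψ (x + z)) * g (x + z) =
        (fun x => (ψ (x - z) - ψ x) * g x) (x + z) := fun x => by
      simp
    have i2' : Integrable (fun x => (ψ x - ψ (x + z)) * g (x + z)) volume := by
      simp only [e2]
      exact i2.comp_add_right z
    have e : ∫ x, (ψ x - ψ (x + z)) * (g x - g (x + z)) =
        ∫ x, (2 * ψ x - ψ (x + z) - ψ (x - z)) * g x := by
      simp only [mul_sub (ψ _ - ψ _)]
      rw [integral_sub i1 i2']
      simp only [e2]
      rw [integral_add_right_eq_self (fun x => (ψ (x - z) - ψ x) * g x) z, ← integral_sub i1 i2]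
      congr 1
      ext x
      ring
    rw [e, ← integral_const_mul]
    refine integral_mono ?_ (ig.const_mul _) fun x => ?_
    · refine (i1.sub i2).congr (.of_forall fun x => ?_)
      simp only [Pi.sub_apply]
      ring
    · exact mul_le_mul_of_nonneg_right (bump_second_difference_le x₀ r x z) (hg0 x)
  have hint := integrable_energy hψ.1 hg.1
  have hint' := (measurePreserving_shear.integrable_comp_emb
      (MeasurableEquiv.shearAddRight (Rd d)).measurableEmbedding).2 hint
  have e1 : ∫ p : Rd d × Rd d, (ψ p.1 - ψ p.2) * (g p.1 - g p.2) / ‖p.1 - p.2‖ ^ ((d : ℝ) + α)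
      ∂((volume : Measure (Rd d)).prod volume) =
      ∫ z, ∫ x, (ψ x - ψ (x + z)) * (g x - g (x + z)) / ‖z‖ ^ ((d : ℝ) + α) := by
    rw [← measurePreserving_shear.integral_comp']
    refine (integral_prod_symm _ hint').trans ?_
    refine integral_congr_ae (.of_forall fun z => integral_congr_ae (.of_forall fun x => ?_))
    change _ / ‖x - (x + z)‖ ^ ((d : ℝ) + α) = _
    rw [sub_add_cancel_left, norm_neg]
    rfl
  have e2 : ∫ z, ∫ x, (ψ x - ψ (x + z)) * (g x - g (x + z)) / ‖z‖ ^ ((d : ℝ) + α) ≤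
      ∫ z, (2 + 2 * r ^ 2) * (∫ x, g x) * J z := by
    refine integral_mono ?_ (hJi.const_mul _) fun z => ?_
    · refine hint'.integral_prod_right.congr (.of_forall fun z =>
        integral_congr_ae (.of_forall fun x => ?_))
      change _ / ‖x - (x + z)‖ ^ ((d : ℝ) + α) = _
      rw [sub_add_cancel_left, norm_neg]
      rfl
    · simp only
      rw [integral_div]
      refine (div_le_div_of_nonneg_right (inner_le z) (by positivity)).trans (le_of_eq ?_)
      rw [hJ]
      ring
  unfold energy
  rw [e1]
  refine (mul_le_mul_of_nonneg_left e2 (by positivity)).trans (le_of_eq ?_)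
  rw [integral_const_mul]
  ring

end Bump

/-! ### Positive parts in `L²` -/

section PosPart

variable {X : Type*} [MeasurableSpace X] {μ : Measure X}

lemma inner_nonneg_of_ae {f g : Lp ℝ 2 μ} (h : ∀ᵐ x ∂μ, 0 ≤ f x * g x) :
    0 ≤ (inner ℝ f g : ℝ) := by
  rw [L2.inner_def]
  refine integral_nonneg_of_ae ?_
  filter_upwards [h] with x hx
  simpa [mul_comm] using hx

/-- The function `w ↦ ‖w₊‖²` on `L²` is differentiable, with gradient `2 w₊`. -/
lemma hasFDerivAt_norm_posPart_sq (w : Lp ℝ 2 μ) :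
    HasFDerivAt (fun v : Lp ℝ 2 μ => ‖Lp.posPart v‖ ^ 2)
      ((2 : ℝ) • innerSL ℝ (Lp.posPart w)) w := by
  have bound : ∀ h : Lp ℝ 2 μ, |‖Lp.posPart (w + h)‖ ^ 2 - ‖Lp.posPart w‖ ^ 2 -
      2 * (inner ℝ (Lp.posPart w) h : ℝ)| ≤ ‖h‖ ^ 2 := by
    intro h
    have upper : ‖Lp.posPart (w + h)‖ ≤ ‖Lp.posPart w + h‖ := by
      refine Lp.norm_le_norm_of_ae_le ?_
      filter_upwards [Lp.coeFn_posPart (w + h), Lp.coeFn_posPart w, Lp.coeFn_add w h,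
        Lp.coeFn_add (Lp.posPart w) h] with x h1 h2 h3 h4
      rw [h1, h4, Pi.add_apply, h2, h3, Pi.add_apply, Real.norm_of_nonneg (le_max_right _ _)]
      refine (max_le ?_ (abs_nonneg _)).trans_eq (Real.norm_eq_abs _).symm
      exact le_trans (by gcongr; exact le_max_left _ _) (le_abs_self _)
    have lower : 0 ≤ (inner ℝ (Lp.posPart w) (Lp.posPart (w + h) - (Lp.posPart w + h)) : ℝ) := by
      refine inner_nonneg_of_ae ?_
      filter_upwards [Lp.coeFn_posPart (w + h), Lp.coeFn_posPart w, Lp.coeFn_add w h,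
        Lp.coeFn_add (Lp.posPart w) h, Lp.coeFn_sub (Lp.posPart (w + h)) (Lp.posPart w + h)]
        with x h1 h2 h3 h4 h5
      rw [h5, Pi.sub_apply, h4, Pi.add_apply, h1, h2, h3, Pi.add_apply]
      rcases le_total (w x) 0 with hx | hx
      · rw [max_eq_right hx, zero_mul]
      · rw [max_eq_left hx]
        exact mul_nonneg hx (sub_nonneg.2 (le_max_left _ _))
    have h1 : ‖Lp.posPart (w + h)‖ ^ 2 ≤ ‖Lp.posPart w + h‖ ^ 2 := by gcongr
    rw [norm_add_sq_real] at h1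
    have h2 := norm_add_sq_real (Lp.posPart w) (Lp.posPart (w + h) - Lp.posPart w)
    rw [add_sub_cancel] at h2
    have h3 : (inner ℝ (Lp.posPart w) (Lp.posPart (w + h) - (Lp.posPart w + h)) : ℝ) =
        inner ℝ (Lp.posPart w) (Lp.posPart (w + h) - Lp.posPart w) -
          inner ℝ (Lp.posPart w) h := by
      rw [← inner_sub_right]; congr 1; abel
    have h4 := sq_nonneg ‖Lp.posPart (w + h) - Lp.posPart w‖
    rw [abs_le]
    constructor <;> nlinarith [sq_nonneg ‖h‖]
  rw [hasFDerivAt_iff_isLittleO_nhds_zero]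
  have hO : (fun h : Lp ℝ 2 μ => ‖Lp.posPart (w + h)‖ ^ 2 - ‖Lp.posPart w‖ ^ 2 -
      ((2 : ℝ) • innerSL ℝ (Lp.posPart w)) h) =O[𝓝 0] fun h => ‖h‖ ^ 2 := by
    refine Asymptotics.IsBigO.of_bound 1 (.of_forall fun h => ?_)
    have := bound h
    simpa using this
  exact hO.trans_isLittleO (Asymptotics.isLittleO_norm_pow_id one_lt_two)

end PosPart

/-! ### Extension by zero -/

section Ext

variable {d : ℕ} {α : ℝ} {Ω : Set (Rd d)}

lemma ext0_ae_eq (hΩ : IsOpen Ω) {f : L2 Ω} {F : Rd d → ℝ}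
    (h : f =ᵐ[volume.restrict Ω] F) : ext0 f =ᵐ[volume] Ω.indicator F := by
  filter_upwards [(ae_restrict_iff' hΩ.measurableSet).1 h] with x hx
  by_cases hxΩ : x ∈ Ω
  · simp [ext0, hxΩ, hx hxΩ]
  · simp [ext0, hxΩ]

lemma ext0_sub (hΩ : IsOpen Ω) (f g : L2 Ω) :
    ext0 (f - g) =ᵐ[volume] fun x => ext0 f x - ext0 g x := by
  refine (ext0_ae_eq hΩ (Lp.coeFn_sub f g)).trans (.of_forall fun x => ?_)
  by_cases hx : x ∈ Ω <;> simp [ext0, hx]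

lemma ext0_smul (hΩ : IsOpen Ω) (c : ℝ) (f : L2 Ω) :
    ext0 (c • f) =ᵐ[volume] fun x => c * ext0 f x := by
  refine (ext0_ae_eq hΩ (Lp.coeFn_smul c f)).trans (.of_forall fun x => ?_)
  by_cases hx : x ∈ Ω <;> simp [ext0, hx]

lemma ext0_posPart (hΩ : IsOpen Ω) (f : L2 Ω) :
    ext0 (Lp.posPart f) =ᵐ[volume] fun x => max (ext0 f x) 0 := by
  refine (ext0_ae_eq hΩ (Lp.coeFn_posPart f)).trans (.of_forall fun x => ?_)
  by_cases hx : x ∈ Ω <;> simp [ext0, hx]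

lemma integral_ext0 (hΩ : IsOpen Ω) (f : L2 Ω) : ∫ x, ext0 f x = ∫ x in Ω, f x :=
  integral_indicator hΩ.measurableSet

lemma exists_ext0_ae_eq (hΩ : IsOpen Ω) {F : Rd d → ℝ} (hF : MemW0 α Ω F) :
    ∃ f : L2 Ω, ext0 f =ᵐ[volume] F ∧ f =ᵐ[volume.restrict Ω] F := by
  have hm := hF.1.1.restrict Ω
  refine ⟨hm.toLp F, (ext0_ae_eq hΩ hm.coeFn_toLp).trans ?_, hm.coeFn_toLp⟩
  filter_upwards [hF.2] with x hx
  by_cases hxΩ : x ∈ Ω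
  · simp [hxΩ]
  · simp [hxΩ, hx hxΩ]

end Ext

/-! ### The operator of the form and the comparison principle -/

section Comparison

variable {d : ℕ} {α : ℝ} {Ω : Set (Rd d)} {W : Rd d → ℝ} {k : ℝ}

lemma inner_eq_setIntegral (f g : L2 Ω) : (inner ℝ f g : ℝ) = ∫ x in Ω, f x * g x := by
  rw [L2.inner_def]
  exact integral_congr_ae (.of_forall fun x => by simp [mul_comm])

lemma integrableOn_mul (f g : L2 Ω) : IntegrableOn (fun x => f x * g x) Ω :=
  (L2.integrable_inner (𝕜 := ℝ) f g).congr (.of_forall fun x => by simp [mul_comm])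

lemma integrableOn_potential (hΩ : IsOpen Ω) (hWm : Measurable W)
    (hW : ∀ x ∈ Ω, 0 ≤ W x ∧ W x ≤ k) (f g : L2 Ω) :
    IntegrableOn (fun x => W x * f x * g x) Ω := by
  have h := (integrableOn_mul f g).bdd_mul (c := k) hWm.aestronglyMeasurable
    ((ae_restrict_iff' hΩ.measurableSet).2 (.of_forall fun x hx => by
      rw [Real.norm_of_nonneg (hW x hx).1]; exact (hW x hx).2))
  exact h.congr (.of_forall fun x => by ring)

lemma inner_comm_of_mem_graph {f g f' g' : L2 Ω} (h : (f, g) ∈ formOperatorGraph α Ω W)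
    (h' : (f', g') ∈ formOperatorGraph α Ω W) : (inner ℝ g f' : ℝ) = inner ℝ f g' := by
  have h1 := h.2 f' h'.1
  have h2 := h'.2 f h.1
  simp only at h1 h2
  rw [← h1, real_inner_comm, ← h2, energy_comm]
  congr 1
  exact integral_congr_ae (.of_forall fun x => by ring)

lemma neg_mul_norm_sq_le_of_mem_graph (hA : 0 ≤ constA d α) (hΩ : IsOpen Ω) (hWm : Measurable W)
    (hW : ∀ x ∈ Ω, 0 ≤ W x ∧ W x ≤ k) {f g : L2 Ω} (h : (f, g) ∈ formOperatorGraph α Ω W) :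
    -k * ‖f‖ ^ 2 ≤ (inner ℝ g f : ℝ) := by
  rw [← h.2 f h.1]
  have h1 := energy_self_nonneg (α := α) hA (ext0 f)
  have h2 : ∫ x in Ω, W x * f x * f x ≤ k * ‖f‖ ^ 2 := by
    rw [← real_inner_self_eq_norm_sq, inner_eq_setIntegral, ← integral_const_mul]
    refine setIntegral_mono_on (integrableOn_potential hΩ hWm hW f f)
      ((integrableOn_mul f f).const_mul k) hΩ.measurableSet fun x hx => ?_
    rw [mul_assoc]
    exact mul_le_mul_of_nonneg_right (hW x hx).2 (mul_self_nonneg _)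
  simp only
  linarith

/-- Comparison principle: if the energy gained by the positive part of `w = s v - S s f` dominates
the defect of `s ↦ s v` from being a subsolution, then `s v ≤ S s f` is preserved. -/
lemma smul_le_apply (hA : 0 ≤ constA d α) (hΩ : IsOpen Ω) (hWm : Measurable W)
    (hW : ∀ x ∈ Ω, 0 ≤ W x ∧ W x ≤ k) {S : ℝ → L2 Ω →L[ℝ] L2 Ω}
    (hS : IsSemigroupOf (formOperatorGraph α Ω W) S) {f v : L2 Ω} (hf : 0 ≤ f) (hv : 0 ≤ v)
    (hvW : MemW0 α Ω (ext0 v)) {T : ℝ} (hT : 0 ≤ T)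
    (h : ∀ s ∈ Set.Ioo 0 T, MemW0 α Ω (ext0 (s • v - S s f)) →
      (inner ℝ v (Lp.posPart (s • v - S s f)) : ℝ) +
        s * energy α (ext0 v) (ext0 (Lp.posPart (s • v - S s f))) ≤
      energy α (ext0 (s • v - S s f)) (ext0 (Lp.posPart (s • v - S s f)))) :
    T • v ≤ S T f := by
  have hsymm : ∀ f g f' g', (f, g) ∈ formOperatorGraph α Ω W →
      (f', g') ∈ formOperatorGraph α Ω W → (inner ℝ g f' : ℝ) = inner ℝ f g' :=
    fun f g f' g' h h' => inner_comm_of_mem_graph h h'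
  have hlow : ∀ f g, (f, g) ∈ formOperatorGraph α Ω W → -k * ‖f‖ ^ 2 ≤ (inner ℝ g f : ℝ) :=
    fun f g h => neg_mul_norm_sq_le_of_mem_graph hA hΩ hWm hW h
  set w : ℝ → L2 Ω := fun s => s • v - S s f with hw
  set F : ℝ → ℝ := fun s => ‖Lp.posPart (w s)‖ ^ 2 with hF
  have hderiv : ∀ s ∈ Set.Ioo 0 T, ∃ F', HasDerivAt F F' s ∧ F' ≤ 2 * k * F s := by
    intro s hs
    obtain ⟨g, hg⟩ := hS.exists_mem hsymm hlow hs.1 f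
    have hd1 : HasDerivAt w (v + g) s := by
      have := ((hasDerivAt_id s).smul_const v).sub (hS.hasDerivAt_of_mem hsymm hlow hs.1 hg)
      rw [one_smul, sub_neg_eq_add] at this
      exact this
    have hd2 := (hasFDerivAt_norm_posPart_sq (w s)).comp_hasDerivAt s hd1
    refine ⟨_, hd2, ?_⟩
    have hSW : MemW0 α Ω (ext0 (S s f)) := hg.1
    have hwW : MemW0 α Ω (ext0 (w s)) := ((hvW.const_mul s).sub hSW).congr <| by
      filter_upwards [ext0_sub hΩ (s • v) (S s f), ext0_smul hΩ s v] with x h1 h2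
      rw [hw, h1, h2]
    have hpW : MemW0 α Ω (ext0 (Lp.posPart (w s))) :=
      hwW.max_zero.congr (ext0_posPart hΩ _).symm
    have he : energy α (ext0 (w s)) (ext0 (Lp.posPart (w s))) =
        s * energy α (ext0 v) (ext0 (Lp.posPart (w s))) -
          energy α (ext0 (S s f)) (ext0 (Lp.posPart (w s))) := by
      rw [← energy_const_mul_left, ← energy_sub_left (hvW.const_mul s).1 hSW.1 hpW.1]
      refine energy_congr ?_ (ae_eq_refl _)
      filter_upwards [ext0_sub hΩ (s • v) (S s f), ext0_smul hΩ s v] with x h1 h2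
      rw [hw, h1, h2]
    -- where `w > 0`, the potential term is at most `W w`, because `v ≥ 0`
    have hpot : -∫ x in Ω, W x * S s f x * Lp.posPart (w s) x ≤ k * F s := by
      rw [hF]
      simp only
      rw [← real_inner_self_eq_norm_sq, inner_eq_setIntegral, ← integral_const_mul,
        ← integral_neg]
      refine integral_mono_ae (integrableOn_potential hΩ hWm hW _ _).neg
        ((integrableOn_mul _ _).const_mul k) ?_
      filter_upwards [Lp.coeFn_posPart (w s), Lp.coeFn_sub (s • v) (S s f), Lp.coeFn_smul s v,
        (Lp.coeFn_nonneg v).2 hv, ae_restrict_mem hΩ.measurableSet] with x h1 h2 h3 h4 hx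
      have hwx : w s x = s * v x - S s f x := by
        rw [hw, h2, Pi.sub_apply, h3, Pi.smul_apply, smul_eq_mul]
      have h4' : 0 ≤ v x := h4
      have hsv : 0 ≤ s * v x := mul_nonneg hs.1.le h4'
      rw [h1]
      rcases le_total (w s x) 0 with h0 | h0
      · simp [max_eq_right h0]
      · rw [max_eq_left h0]
        have h5 : -S s f x ≤ w s x := by linarith
        have h6 : W x * (-S s f x * w s x) ≤ W x * (w s x * w s x) :=
          mul_le_mul_of_nonneg_left (mul_le_mul_of_nonneg_right h5 h0) (hW x hx).1
        have h7 : W x * (w s x * w s x) ≤ k * (w s x * w s x) :=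
          mul_le_mul_of_nonneg_right (hW x hx).2 (mul_self_nonneg _)
        linarith
    have h1 := h s hs hwW
    have h2 := hg.2 _ hpW
    simp only at h2
    have h3 : ((2 : ℝ) • innerSL ℝ (Lp.posPart (w s))) (v + g) =
        2 * ((inner ℝ v (Lp.posPart (w s)) : ℝ) + inner ℝ g (Lp.posPart (w s))) := by
      simp only [_root_.smul_apply, innerSL_apply_apply, smul_eq_mul, inner_add_right]
      rw [real_inner_comm v, real_inner_comm g]
    rw [h3]
    simp only [hw] at h1 h2 he hpot ⊢
    linarith
  have hcont : ContinuousOn F (Set.Icc 0 T) := by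
    have hwc : ContinuousOn w (Set.Icc 0 T) :=
      ContinuousOn.sub (by fun_prop) ((hS.cont f).mono Set.Icc_subset_Ici_self)
    exact ((Lp.continuous_posPart.comp_continuousOn hwc).norm).pow 2
  choose! F' hF' hF'le using hderiv
  have hanti : AntitoneOn (fun s => F s * Real.exp (-(2 * k) * s)) (Set.Icc 0 T) := by
    refine antitoneOn_of_hasDerivWithinAt_nonpos (convex_Icc 0 T)
      (f' := fun s => (F' s - 2 * k * F s) * Real.exp (-(2 * k) * s))
      (hcont.mul (by fun_prop)) (fun s hs => ?_) fun s hs => ?_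
    · rw [interior_Icc] at hs ⊢
      have he : HasDerivAt (fun s : ℝ => Real.exp (-(2 * k) * s))
          (Real.exp (-(2 * k) * s) * (-(2 * k))) s := by
        simpa using ((hasDerivAt_id s).const_mul (-(2 * k))).exp
      refine (((hF' s hs).mul he).congr_deriv ?_).hasDerivWithinAt
      ring
    · rw [interior_Icc] at hs
      exact mul_nonpos_of_nonpos_of_nonneg (by linarith [hF'le s hs]) (Real.exp_nonneg _)
  have h0 : F 0 = 0 := by
    have : Lp.posPart (w 0) = 0 := by
      refine Lp.ext ?_
      filter_upwards [Lp.coeFn_posPart (w 0), Lp.coeFn_neg f, (Lp.coeFn_nonneg f).2 hf,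
        Lp.coeFn_zero ℝ 2 (volume.restrict Ω)] with x h1 h2 h3 h4
      have hw0 : w 0 = -f := by simp [hw, hS.apply_zero]
      have h3' : 0 ≤ f x := h3
      rw [h1, hw0, h2, h4, Pi.neg_apply]
      exact max_eq_right (by simpa using h3')
    simp [hF, this]
  have hT' := hanti (Set.left_mem_Icc.2 hT) (Set.right_mem_Icc.2 hT) hT
  simp only [h0, zero_mul] at hT'
  have hFT : F T = 0 :=
    le_antisymm (nonpos_of_mul_nonpos_left hT' (Real.exp_pos _)) (sq_nonneg _)
  have hpT : Lp.posPart (w T) = 0 := by simpa [hF] using hFT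
  rw [← Lp.coeFn_le]
  filter_upwards [Lp.coeFn_posPart (w T), Lp.coeFn_sub (T • v) (S T f),
    Lp.coeFn_zero ℝ 2 (volume.restrict Ω)] with x h1 h2 h3
  rw [hpT, h3] at h1
  have h4 : w T x ≤ 0 := max_eq_right_iff.1 h1.symm
  rw [hw] at h4
  simp only at h4
  rw [h2, Pi.sub_apply] at h4
  linarith

end Comparison

/-! ### Positivity and local lower bounds for the semigroup -/

section Positivity

variable {d : ℕ} {α : ℝ} {Ω : Set (Rd d)} {W : Rd d → ℝ} {k : ℝ}
  {S : ℝ → L2 Ω →L[ℝ] L2 Ω} {f : L2 Ω} {t : ℝ}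

lemma apply_nonneg (hd : 0 < d) (h0 : 0 < α) (h2 : α < 2) (hΩ : IsOpen Ω)
    (hΩb : Bornology.IsBounded Ω) (hWm : Measurable W) (hW : ∀ x ∈ Ω, 0 ≤ W x ∧ W x ≤ k)
    (hS : IsSemigroupOf (formOperatorGraph α Ω W) S) (hf : 0 ≤ f) (ht : 0 ≤ t) :
    0 ≤ S t f := by
  have hd' : 0 < (d : ℝ) := Nat.cast_pos.2 hd
  obtain ⟨c, hc, hcE⟩ := exists_mul_integral_le_energy hd' h0 h2 hΩ hΩb
  have hz : ext0 (0 : L2 Ω) =ᵐ[volume] fun _ => 0 := by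
    refine (ext0_ae_eq hΩ (Lp.coeFn_zero ℝ 2 (volume.restrict Ω))).trans (.of_forall fun x => ?_)
    by_cases hx : x ∈ Ω <;> simp [hx]
  have hzW : MemW0 α Ω (ext0 (0 : L2 Ω)) := by
    have h : MemW0 α Ω (fun _ : Rd d => (0 : ℝ)) :=
      ⟨⟨MemLp.zero', by simp⟩, .of_forall fun _ _ => rfl⟩
    exact h.congr hz.symm
  have := smul_le_apply (constA_pos hd' h0 h2).le hΩ hWm hW hS hf le_rfl hzW ht
    fun s hs hw => ?_
  · simpa using this
  · rw [energy_congr hz (ae_eq_refl _), energy_zero_left, mul_zero, inner_zero_left, add_zero,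
      energy_congr (ae_eq_refl _) (ext0_posPart hΩ _)]
    refine le_trans ?_ (hcE _ hw)
    have h1 : 0 ≤ ∫ x, max (ext0 (s • 0 - S s f) x) 0 :=
      integral_nonneg fun x => le_max_right _ _
    have h2 : 0 ≤ ∫ x, max (-ext0 (s • 0 - S s f) x) 0 :=
      integral_nonneg fun x => le_max_right _ _
    positivity

/-- The total mass stays away from zero on compact time intervals. -/
lemma exists_le_integral_apply (hd : 0 < d) (h0 : 0 < α) (h2 : α < 2) (hΩ : IsOpen Ω)
    (hΩb : Bornology.IsBounded Ω) (hWm : Measurable W) (hW : ∀ x ∈ Ω, 0 ≤ W x ∧ W x ≤ k)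
    (hS : IsSemigroupOf (formOperatorGraph α Ω W) S) (hf : 0 ≤ f) (hf0 : f ≠ 0) (ht : 0 ≤ t) :
    ∃ m : ℝ, 0 < m ∧ ∀ s ∈ Set.Icc 0 t, m ≤ ∫ x, ext0 (S s f) x := by
  have hfin : IsFiniteMeasure (volume.restrict Ω) := ⟨by
    rw [Measure.restrict_apply_univ]; exact hΩb.measure_lt_top⟩
  set e : L2 Ω := Lp.const 2 (volume.restrict Ω) (1 : ℝ) with he
  have hmass : ∀ g : L2 Ω, ∫ x, ext0 g x = (inner ℝ e g : ℝ) := by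
    intro g
    rw [integral_ext0 hΩ, inner_eq_setIntegral]
    refine integral_congr_ae ?_
    filter_upwards [Lp.coeFn_const (p := 2) (μ := volume.restrict Ω) (1 : ℝ)] with x hx
    rw [he, hx]
    simp
  have hcont : ContinuousOn (fun s => ∫ x, ext0 (S s f) x) (Set.Icc 0 t) := by
    simp only [hmass]
    exact continuousOn_const.inner ((hS.cont f).mono Set.Icc_subset_Ici_self)
  obtain ⟨s, hs, hmin⟩ := isCompact_Icc.exists_isMinOn (Set.nonempty_Icc.2 ht) hcont
  refine ⟨_, ?_, fun s' hs' => hmin hs'⟩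
  have hne : S s f ≠ 0 :=
    hS.apply_ne_zero (fun _ _ _ _ h h' => inner_comm_of_mem_graph h h') hs.1 hf0
  have hnn := apply_nonneg hd h0 h2 hΩ hΩb hWm hW hS hf hs.1
  change 0 < ∫ x, ext0 (S s f) x
  rw [integral_ext0 hΩ]
  have hnn' : 0 ≤ᵐ[volume.restrict Ω] S s f := (Lp.coeFn_nonneg _).2 hnn
  refine lt_of_le_of_ne (integral_nonneg_of_ae hnn') fun h => hne ?_
  have hi : IntegrableOn (S s f) Ω := (Lp.memLp (S s f)).integrable (by norm_num)
  exact Lp.eq_zero_iff_ae_eq_zero.2 ((integral_eq_zero_iff_of_nonneg_ae hnn' hi).1 h.symm)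

lemma inner_posPart_le (hΩ : IsOpen Ω) (hΩb : Bornology.IsBounded Ω) {v w : L2 Ω} {M : ℝ}
    (hv : ∀ᵐ x ∂(volume.restrict Ω), v x ≤ M) (hw : MemW0 α Ω (ext0 w)) :
    (inner ℝ v (Lp.posPart w) : ℝ) ≤ M * ∫ x, max (ext0 w x) 0 := by
  have hpe := ext0_posPart hΩ w
  have hpi : Integrable (ext0 (Lp.posPart w)) volume :=
    (hw.max_zero.integrable hΩ hΩb).congr hpe.symm
  have hpi' : IntegrableOn (Lp.posPart w) Ω := (integrable_indicator_iff hΩ.measurableSet).1 hpi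
  rw [← integral_congr_ae hpe, integral_ext0 hΩ, inner_eq_setIntegral, ← integral_const_mul]
  refine integral_mono_ae (integrableOn_mul _ _) (hpi'.const_mul _) ?_
  filter_upwards [hv, Lp.coeFn_posPart w] with x h1 h2
  refine mul_le_mul_of_nonneg_right h1 ?_
  rw [h2]
  exact le_max_right _ _

lemma integral_ext0_smul_sub (hΩ : IsOpen Ω) (hΩb : Bornology.IsBounded Ω) (s : ℝ) (v g : L2 Ω) :
    ∫ x, ext0 (s • v - g) x = s * (∫ x, ext0 v x) - ∫ x, ext0 g x := by
  have hfin : IsFiniteMeasure (volume.restrict Ω) := ⟨by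
    rw [Measure.restrict_apply_univ]; exact hΩb.measure_lt_top⟩
  have hi : ∀ g : L2 Ω, IntegrableOn g Ω := fun g => (Lp.memLp g).integrable (by norm_num)
  rw [integral_ext0 hΩ, integral_ext0 hΩ, integral_ext0 hΩ, ← integral_const_mul,
    ← integral_sub ((hi v).const_mul s) (hi g)]
  refine integral_congr_ae ?_
  filter_upwards [Lp.coeFn_sub (s • v) g, Lp.coeFn_smul s v] with x h1 h2
  rw [h1, Pi.sub_apply, h2, Pi.smul_apply, smul_eq_mul]

lemma neg_integral_le (hΩ : IsOpen Ω) (hΩb : Bornology.IsBounded Ω) {w : Rd d → ℝ}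
    (hw : MemW0 α Ω w) : -∫ x, w x ≤ ∫ x, max (-w x) 0 := by
  have hwi := hw.integrable hΩ hΩb
  rw [← integral_neg]
  exact integral_mono hwi.neg hwi.neg.pos_part fun x => le_max_left _ _

/-- A multiple `v` of a bump stays below the solution when scaled by time, provided that the
negative effect of its own fractional Laplacian is outweighed by the mass of the solution. -/
lemma smul_le_apply_of_mass (hd : 0 < d) (h0 : 0 < α) (h2 : α < 2) (hΩ : IsOpen Ω)
    (hΩb : Bornology.IsBounded Ω) (hWm : Measurable W) (hW : ∀ x ∈ Ω, 0 ≤ W x ∧ W x ≤ k)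
    (hS : IsSemigroupOf (formOperatorGraph α Ω W) S) (hf : 0 ≤ f) (ht : 0 ≤ t)
    {v : L2 Ω} (hv0 : 0 ≤ v) (hvW : MemW0 α Ω (ext0 v)) {c C m M : ℝ} (hc : 0 ≤ c) (hC : 0 ≤ C)
    (hcE : ∀ w : Rd d → ℝ, MemW0 α Ω w →
      c * ((∫ x, max (w x) 0) * ∫ x, max (-w x) 0) ≤ energy α w (fun x => max (w x) 0))
    (hCE : ∀ g : Rd d → ℝ, MemW0 α Ω g → (∀ x, 0 ≤ g x) → energy α (ext0 v) g ≤ C * ∫ x, g x)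
    (hM : ∀ᵐ x ∂(volume.restrict Ω), v x ≤ M)
    (hm : ∀ s ∈ Set.Icc 0 t, m ≤ ∫ x, ext0 (S s f) x)
    (hle : M + t * C ≤ c * (m - t * ∫ x, ext0 v x)) : t • v ≤ S t f := by
  refine smul_le_apply (constA_pos (Nat.cast_pos.2 hd) h0 h2).le hΩ hWm hW hS hf hv0 hvW ht
    fun s hs hw => ?_
  have hpe := ext0_posPart hΩ (s • v - S s f)
  have a1 := inner_posPart_le hΩ hΩb hM hw
  have a2 := hCE _ hw.max_zero fun x => le_max_right _ _
  have a3 := hcE _ hw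
  have a4 := neg_integral_le hΩ hΩb hw
  rw [integral_ext0_smul_sub hΩ hΩb] at a4
  rw [energy_congr (ae_eq_refl _) hpe, energy_congr (ae_eq_refl _) hpe]
  have hI : 0 ≤ ∫ x, ext0 v x := by
    rw [integral_ext0 hΩ]
    exact integral_nonneg_of_ae ((Lp.coeFn_nonneg v).2 hv0)
  have hP : 0 ≤ ∫ x, max (ext0 (s • v - S s f) x) 0 := integral_nonneg fun x => le_max_right _ _
  have a5 := hm s ⟨hs.1.le, hs.2.le⟩
  generalize ∫ x, max (ext0 (s • v - S s f) x) 0 = P at *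
  generalize ∫ x, max (-ext0 (s • v - S s f) x) 0 = N at *
  generalize ∫ x, ext0 v x = I at *
  generalize ∫ x, ext0 (S s f) x = m' at *
  generalize energy α (ext0 v) _ = E₁ at *
  generalize energy α _ _ = E₂ at *
  have a6 : s * I ≤ t * I := mul_le_mul_of_nonneg_right hs.2.le hI
  have a7 : s * E₁ ≤ t * (C * P) :=
    (mul_le_mul_of_nonneg_left a2 hs.1.le).trans
      (mul_le_mul_of_nonneg_right hs.2.le (mul_nonneg hC hP))
  have a8 : c * (P * (m - t * I)) ≤ c * (P * N) :=
    mul_le_mul_of_nonneg_left (mul_le_mul_of_nonneg_left (by linarith) hP) hc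
  have a9 := mul_le_mul_of_nonneg_right hle hP
  linarith

/-- Every small ball in `Ω` carries a lower bound. The multiple `ε` of the bump is so small that the
mass of the solution jumping into the ball makes `s ↦ ε s (r² - |x - x₀|²)₊` a subsolution. -/
lemma exists_le_apply_ball (hd : 0 < d) (h0 : 0 < α) (h2 : α < 2) (hΩ : IsOpen Ω)
    (hΩb : Bornology.IsBounded Ω) (hWm : Measurable W) (hW : ∀ x ∈ Ω, 0 ≤ W x ∧ W x ≤ k)
    (hS : IsSemigroupOf (formOperatorGraph α Ω W) S) (hf : 0 ≤ f) (hf0 : f ≠ 0) (ht : 0 < t)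
    {x₀ : Rd d} {r : ℝ} (hr : 0 < r) (hB : Metric.closedBall x₀ r ⊆ Ω) :
    ∃ c : ℝ, 0 < c ∧ ∀ᵐ x ∂(volume : Measure (Rd d)),
      x ∈ Metric.ball x₀ (r / 2) → c ≤ ext0 (S t f) x := by
  have hψ := memW0_bump hd h0 h2 hr.le hB
  obtain ⟨c, hc, hcE⟩ := exists_mul_integral_le_energy (Nat.cast_pos.2 hd) h0 h2 hΩ hΩb
  obtain ⟨C, hC, hCE⟩ := exists_energy_bump_le hd h0 h2 hΩ hΩb hr.le hB
  obtain ⟨m, hm, hmS⟩ := exists_le_integral_apply hd h0 h2 hΩ hΩb hWm hW hS hf hf0 ht.le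
  have hI : 0 ≤ ∫ x, bump x₀ r x := integral_nonneg (bump_nonneg x₀ r)
  obtain ⟨ε, hε, hεeq⟩ : ∃ ε : ℝ, 0 < ε ∧
      ε * r ^ 2 + t * (ε * C) = c * (m - t * (ε * ∫ x, bump x₀ r x)) := by
    have hden : 0 < r ^ 2 + t * C + c * t * ∫ x, bump x₀ r x := by positivity
    refine ⟨c * m / (r ^ 2 + t * C + c * t * ∫ x, bump x₀ r x), by positivity, ?_⟩
    field_simp
    ring
  obtain ⟨v, hv1, hv2⟩ := exists_ext0_ae_eq hΩ (hψ.const_mul ε)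
  have hv0 : 0 ≤ v := by
    refine (Lp.coeFn_nonneg _).1 ?_
    filter_upwards [hv2] with x hx
    rw [hx]
    exact mul_nonneg hε.le (bump_nonneg _ _ _)
  have hle : t • v ≤ S t f := by
    refine smul_le_apply_of_mass hd h0 h2 hΩ hΩb hWm hW hS hf ht.le hv0
      ((hψ.const_mul ε).congr hv1.symm) hc.le (mul_nonneg hε.le hC) hcE (fun g hg hg0 => ?_)
      (M := ε * r ^ 2) ?_ hmS ?_
    · rw [energy_congr hv1 (ae_eq_refl _), energy_const_mul_left, mul_assoc]
      exact mul_le_mul_of_nonneg_left (hCE g hg hg0) hε.le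
    · filter_upwards [hv2] with x hx
      rw [hx]
      exact mul_le_mul_of_nonneg_left (bump_le _ _ _) hε.le
    · rw [integral_congr_ae hv1, integral_const_mul, hεeq]
  refine ⟨t * (ε * (3 / 4 * r ^ 2)), by positivity, ?_⟩
  rw [← Lp.coeFn_le] at hle
  have hlow : ∀ᵐ x ∂(volume.restrict Ω), t * (ε * bump x₀ r x) ≤ S t f x := by
    filter_upwards [hle, Lp.coeFn_smul t v, hv2] with x h1 h3 h4
    rwa [h3, Pi.smul_apply, h4, smul_eq_mul] at h1
  filter_upwards [(ae_restrict_iff' hΩ.measurableSet).1 hlow] with x h1 hx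
  have hxr : ‖x - x₀‖ < r / 2 := by rwa [Metric.mem_ball, dist_eq_norm] at hx
  have hxΩ : x ∈ Ω := hB (by rw [Metric.mem_closedBall, dist_eq_norm]; linarith)
  have h6 : 3 / 4 * r ^ 2 ≤ bump x₀ r x := by
    refine le_trans ?_ (le_max_left _ _)
    nlinarith [norm_nonneg (x - x₀)]
  rw [ext0, Set.indicator_of_mem hxΩ]
  refine le_trans ?_ (h1 hxΩ)
  gcongr

lemma exists_le_apply_compact (hd : 0 < d) (h0 : 0 < α) (h2 : α < 2) (hΩ : IsOpen Ω)
    (hΩb : Bornology.IsBounded Ω) (hWm : Measurable W) (hW : ∀ x ∈ Ω, 0 ≤ W x ∧ W x ≤ k)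
    (hS : IsSemigroupOf (formOperatorGraph α Ω W) S) (hf : 0 ≤ f) (hf0 : f ≠ 0) (ht : 0 < t)
    {K : Set (Rd d)} (hK : IsCompact K) (hKΩ : K ⊆ Ω) :
    ∃ c : ℝ, 0 < c ∧ ∀ᵐ x ∂(volume : Measure (Rd d)), x ∈ K → c ≤ ext0 (S t f) x := by
  refine hK.induction_on (p := fun A => ∃ c : ℝ, 0 < c ∧
    ∀ᵐ x ∂(volume : Measure (Rd d)), x ∈ A → c ≤ ext0 (S t f) x) ?_ ?_ ?_ ?_
  · exact ⟨1, one_pos, .of_forall fun x hx => hx.elim⟩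
  · rintro A B hAB ⟨c, hc, h⟩
    exact ⟨c, hc, h.mono fun x hx hxA => hx (hAB hxA)⟩
  · rintro A B ⟨a, ha, hA⟩ ⟨b, hb, hB⟩
    refine ⟨min a b, lt_min ha hb, ?_⟩
    filter_upwards [hA, hB] with x h1 h2 hx
    rcases hx with hx | hx
    · exact (min_le_left _ _).trans (h1 hx)
    · exact (min_le_right _ _).trans (h2 hx)
  · intro x hx
    obtain ⟨r, hr, hB⟩ := Metric.nhds_basis_closedBall.mem_iff.1 (hΩ.mem_nhds (hKΩ hx))
    exact ⟨_, mem_nhdsWithin_of_mem_nhds (Metric.ball_mem_nhds x (half_pos hr)),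
      exists_le_apply_ball hd h0 h2 hΩ hΩb hWm hW hS hf hf0 ht hr hB⟩

lemma ae_apply_pos (hd : 0 < d) (h0 : 0 < α) (h2 : α < 2) (hΩ : IsOpen Ω)
    (hΩb : Bornology.IsBounded Ω) (hWm : Measurable W) (hW : ∀ x ∈ Ω, 0 ≤ W x ∧ W x ≤ k)
    (hS : IsSemigroupOf (formOperatorGraph α Ω W) S) (hf : 0 ≤ f) (hf0 : f ≠ 0) (ht : 0 < t) :
    ∀ᵐ x ∂(volume : Measure (Rd d)), x ∈ Ω → 0 < ext0 (S t f) x := by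
  rw [ae_iff]
  refine measure_null_of_locally_null _ fun x hx => ?_
  simp only [Classical.not_imp, Set.mem_ofPred_eq] at hx
  obtain ⟨r, hr, hB⟩ := Metric.nhds_basis_closedBall.mem_iff.1 (hΩ.mem_nhds hx.1)
  obtain ⟨c, hc, h⟩ := exists_le_apply_ball hd h0 h2 hΩ hΩb hWm hW hS hf hf0 ht hr hB
  refine ⟨_, inter_mem_nhdsWithin _ (Metric.ball_mem_nhds x (half_pos hr)), ?_⟩
  refine measure_mono_null (fun y hy => ?_) (ae_iff.1 h)
  intro hy'
  exact hy.1 fun _ => hc.trans_le (hy' hy.2)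

end Positivity

/-! ### The ground state inequality -/

section Picone

variable {d : ℕ} {α : ℝ} {Ω : Set (Rd d)} {u φ : Rd d → ℝ}

/-- The discrete Picone inequality. The value `φ² / 0 = 0` is the right one at points where both
functions vanish. -/
lemma picone {a b p q : ℝ} (ha : 0 ≤ a) (hb : 0 ≤ b) (hp : p = 0 ∨ 0 < a) (hq : q = 0 ∨ 0 < b) :
    (a - b) * (p ^ 2 / a - q ^ 2 / b) ≤ (p - q) ^ 2 := by
  rcases hp with rfl | ha'
  · rcases hq with rfl | hb'
    · simp
    · have e : (a - b) * (0 ^ 2 / a - q ^ 2 / b) = q ^ 2 - a * (q ^ 2 / b) := by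
        field_simp; ring
      rw [e]
      have : 0 ≤ a * (q ^ 2 / b) := by positivity
      nlinarith
  · rcases hq with rfl | hb'
    · have e : (a - b) * (p ^ 2 / a - 0 ^ 2 / b) = p ^ 2 - b * (p ^ 2 / a) := by
        field_simp; ring
      rw [e]
      have : 0 ≤ b * (p ^ 2 / a) := by positivity
      nlinarith
    · have e : (p - q) ^ 2 - (a - b) * (p ^ 2 / a - q ^ 2 / b) =
          (b * p - a * q) ^ 2 / (a * b) := by
        field_simp; ring
      have : 0 ≤ (b * p - a * q) ^ 2 / (a * b) := by positivity
      linarith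

lemma sq_div_sub_le {a b p q c M : ℝ} (hc : 0 < c) (hp : p = 0 ∨ c ≤ a) (hq : q = 0 ∨ c ≤ b)
    (hpM : |p| ≤ M) (hqM : |q| ≤ M) :
    (p ^ 2 / a - q ^ 2 / b) ^ 2 ≤
      8 * (M / c) ^ 2 * (p - q) ^ 2 + 2 * (M / c) ^ 4 * (a - b) ^ 2 := by
  have hM : 0 ≤ M := (abs_nonneg _).trans hpM
  have bd : ∀ y s : ℝ, |y| ≤ M → c ≤ s → (y / s) ^ 2 ≤ (M / c) ^ 2 := by
    intro y s hy hs
    have hs0 := hc.trans_le hs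
    rw [← sq_abs, abs_div, abs_of_pos hs0]
    gcongr
  have one : ∀ y s : ℝ, |y| ≤ M → c ≤ s → (y ^ 2 / s) ^ 2 ≤ (M / c) ^ 2 * y ^ 2 := by
    intro y s hy hs
    have := mul_le_mul_of_nonneg_right (bd y s hy hs) (sq_nonneg y)
    calc (y ^ 2 / s) ^ 2 = (y / s) ^ 2 * y ^ 2 := by ring
      _ ≤ _ := this
  rcases hp with rfl | hp
  · rcases hq with rfl | hq
    · simp only [ne_eq, OfNat.ofNat_ne_zero, not_false_eq_true, zero_pow, zero_div, sub_self]
      positivity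
    · have h := one q b hqM hq
      have h' : 0 ≤ 7 * (M / c) ^ 2 * q ^ 2 + 2 * (M / c) ^ 4 * (a - b) ^ 2 := by positivity
      have e : ((0 : ℝ) ^ 2 / a - q ^ 2 / b) ^ 2 = (q ^ 2 / b) ^ 2 := by simp
      rw [e]
      linarith
  · rcases hq with rfl | hq
    · have h := one p a hpM hp
      have h' : 0 ≤ 7 * (M / c) ^ 2 * p ^ 2 + 2 * (M / c) ^ 4 * (a - b) ^ 2 := by positivity
      have e : (p ^ 2 / a - (0 : ℝ) ^ 2 / b) ^ 2 = (p ^ 2 / a) ^ 2 := by simp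
      rw [e]
      linarith
    · have ha := hc.trans_le hp
      have hb := hc.trans_le hq
      have e : p ^ 2 / a - q ^ 2 / b =
          (p / a + q / a) * (p - q) - (q / a) * (q / b) * (a - b) := by
        field_simp; ring
      set P := p / a
      set Q := q / a
      set R := q / b
      have h1 : P ^ 2 ≤ (M / c) ^ 2 := bd p a hpM hp
      have h2 : Q ^ 2 ≤ (M / c) ^ 2 := bd q a hqM hp
      have h3 : R ^ 2 ≤ (M / c) ^ 2 := bd q b hqM hq
      have h4 : (P + Q) ^ 2 ≤ 4 * (M / c) ^ 2 := by nlinarith [sq_nonneg (P - Q)]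
      have h5 : (Q * R) ^ 2 ≤ (M / c) ^ 4 := by
        have := mul_le_mul h2 h3 (sq_nonneg R) (sq_nonneg _)
        calc (Q * R) ^ 2 = Q ^ 2 * R ^ 2 := by ring
          _ ≤ _ := this
          _ = _ := by ring
      have h6 := mul_le_mul_of_nonneg_right h4 (sq_nonneg (p - q))
      have h7 := mul_le_mul_of_nonneg_right h5 (sq_nonneg (a - b))
      rw [e]
      calc ((P + Q) * (p - q) - Q * R * (a - b)) ^ 2
          ≤ 2 * ((P + Q) ^ 2 * (p - q) ^ 2) + 2 * ((Q * R) ^ 2 * (a - b) ^ 2) := by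
            nlinarith [sq_nonneg ((P + Q) * (p - q) + Q * R * (a - b))]
        _ ≤ _ := by linarith

lemma memW0_sq_div {c M : ℝ} (hc : 0 < c) (hu : MemW0 α Ω u) (hφ : MemW0 α Ω φ)
    (hφM : ∀ᵐ x ∂(volume : Measure (Rd d)), |φ x| ≤ M)
    (hφu : ∀ᵐ x ∂(volume : Measure (Rd d)), φ x = 0 ∨ c ≤ u x) :
    MemW0 α Ω (fun x => φ x ^ 2 / u x) := by
  have hLp : MemLp (fun x => φ x ^ 2 / u x) 2 volume := by
    refine (hφ.1.1.const_mul (M / c)).mono ((hφ.1.1.1.pow 2).div₀ hu.1.1.1) ?_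
    filter_upwards [hφM, hφu] with x h1 h2
    have hM : 0 ≤ M := (abs_nonneg _).trans h1
    rcases h2 with h2 | h2
    · simp [h2]
    · rw [norm_div, norm_mul, norm_pow, Real.norm_eq_abs, Real.norm_eq_abs, Real.norm_eq_abs,
        abs_of_nonneg (show 0 ≤ M / c by positivity), abs_of_pos (hc.trans_le h2)]
      calc |φ x| ^ 2 / u x = |φ x| / u x * |φ x| := by ring
        _ ≤ M / c * |φ x| := by gcongr
  refine ⟨hφ.1.of_sq_sub_le hu.1 hLp (8 * (M / c) ^ 2) (2 * (M / c) ^ 4) (hφM.and hφu)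
    fun x y hx hy => sq_div_sub_le hc hx.2 hy.2 hx.1 hy.1, ?_⟩
  filter_upwards [hφ.2] with x hx hxΩ
  simp [hx hxΩ]

end Picone

end FracHeat

theorem mainTheorem5 (d : ℕ) (α : ℝ) (hα0 : 0 < α) (hα : α < min 2 (d : ℝ))
    (Ω : Set (FracHeat.Rd d)) (hΩo : IsOpen Ω) (hΩb : Bornology.IsBounded Ω)
    (V : FracHeat.Rd d → ℝ) (hVm : Measurable V) (hV0 : ∀ x ∈ Ω, 0 ≤ V x)
    (hVloc : LocallyIntegrableOn V Ω volume)
    (u₀ : FracHeat.L2 Ω) (hu₀ : 0 ≤ u₀) (hu₀ne : u₀ ≠ 0)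
    (k : ℕ)
    -- `S t = e^{-t L_k}`, where `L_k` is associated with the form `E_Ω - (V ∧ k)`
    (S : ℝ → FracHeat.L2 Ω →L[ℝ] FracHeat.L2 Ω)
    (hS : FracHeat.IsSemigroupOf
      (FracHeat.formOperatorGraph α Ω (fun x => min (V x) (k : ℝ))) S)
    -- `u t = u_k(t) = e^{-t L_k} u₀`, extended by zero outside `Ω`
    (u : ℝ → FracHeat.Rd d → ℝ) (hu : ∀ t : ℝ, u t = FracHeat.ext0 (S t u₀))
    (φ : FracHeat.Rd d → ℝ) (hφ : FracHeat.MemW0 α Ω φ) (hφb : MemLp φ ⊤ volume)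
    -- the (essential) support of `φ` is a compact subset of `Ω`
    (hφs : ∃ K : Set (FracHeat.Rd d), IsCompact K ∧ K ⊆ Ω ∧
      ∀ᵐ x ∂(volume : Measure (FracHeat.Rd d)), x ∉ K → φ x = 0)
    (t : ℝ) (ht : 0 < t) :
    (∀ᵐ x ∂(volume : Measure (FracHeat.Rd d)), x ∈ Ω → 0 < u t x) ∧
    FracHeat.MemW0 α Ω (u t) ∧
    FracHeat.MemW0 α Ω (fun x => φ x ^ 2 / u t x) ∧
    FracHeat.energy α (u t) (fun x => φ x ^ 2 / u t x) ≤ FracHeat.energy α φ φ := by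
  obtain ⟨hα2, hαd⟩ := lt_min_iff.1 hα
  have hd : 0 < d := Nat.cast_pos.1 (hα0.trans hαd)
  have hA := (FracHeat.constA_pos (Nat.cast_pos.2 hd) hα0 hα2).le
  have hWm : Measurable fun x => min (V x) (k : ℝ) := hVm.min measurable_const
  have hW : ∀ x ∈ Ω, 0 ≤ min (V x) (k : ℝ) ∧ min (V x) (k : ℝ) ≤ k := fun x hx =>
    ⟨le_min (hV0 x hx) (Nat.cast_nonneg k), min_le_right _ _⟩
  obtain ⟨K, hK, hKΩ, hφK⟩ := hφs
  obtain ⟨c, hc, hcK⟩ := FracHeat.exists_le_apply_compact hd hα0 hα2 hΩo hΩb hWm hW hS hu₀ hu₀ne ht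
    hK hKΩ
  have hpos := FracHeat.ae_apply_pos hd hα0 hα2 hΩo hΩb hWm hW hS hu₀ hu₀ne ht
  obtain ⟨g, hg⟩ := hS.exists_mem
    (fun _ _ _ _ h h' => FracHeat.inner_comm_of_mem_graph h h')
    (fun _ _ h => FracHeat.neg_mul_norm_sq_le_of_mem_graph hA hΩo hWm hW h) ht u₀
  have huW : FracHeat.MemW0 α Ω (u t) := by
    rw [hu]
    exact hg.1
  rw [← hu] at hcK hpos
  have hφM : ∀ᵐ x ∂(volume : Measure (FracHeat.Rd d)),
      |φ x| ≤ (eLpNorm φ ⊤ volume).toReal := by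
    filter_upwards [ae_le_eLpNormEssSup (f := φ) (μ := volume)] with x hx
    rw [← eLpNorm_exponent_top] at hx
    simpa using ENNReal.toReal_mono hφb.2.ne hx
  have hφu : ∀ᵐ x ∂(volume : Measure (FracHeat.Rd d)), φ x = 0 ∨ c ≤ u t x := by
    filter_upwards [hcK, hφK] with x h1 h2
    by_cases hx : x ∈ K
    · exact Or.inr (h1 hx)
    · exact Or.inl (h2 hx)
  have hquot := FracHeat.memW0_sq_div hc huW hφ hφM hφu
  have hu0 : ∀ᵐ x ∂(volume : Measure (FracHeat.Rd d)), 0 ≤ u t x := by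
    filter_upwards [hpos, huW.2] with x h1 h2
    by_cases hx : x ∈ Ω
    · exact (h1 hx).le
    · exact (h2 hx).ge
  refine ⟨hpos, huW, hquot, ?_⟩
  refine FracHeat.energy_le_energy hA huW.1 hquot.1 hφ.1 hφ.1 (hu0.and hφu) fun x y hx hy => ?_
  rw [← sq (φ x - φ y)]
  exact FracHeat.picone hx.1 hy.1 (hx.2.imp_right hc.trans_le) (hy.2.imp_right hc.trans_le)
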